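/- The Strong Exponential Time Hypothesis (SETH) says that CNF-SAT on $n$ variables and $O(n)$ clauses requires $2^{n-o(n)}$ time, i.e., that for every $\delta>0$ there is a constant $c$ such that no algorithm decides the satisfiability of CNF formulas with $n$ variables and at most $cn$ clauses in time $O(2^{(1-\delta)n})$. An $\alpha$-approximation algorithm for the diameter is an algorithm that, given a connected undirected unweighted graph of diameter $D$, outputs a rational estimate $\hat D$ with $\hat D\le D\le\alpha\hat D$. **Theorem.** Assuming SETH, for every $\varepsilon>0$, a $(\frac74-\varepsilon)$-approximation of the diameter of undirected unweighted graphs with $m$ edges needs $m^{4/3-o(1)}$ time. That is, if SETH holds, then for all $\varepsilon>0$ and $\delta>0$ there is no $(\frac74-\varepsilon)$-approximation algorithm for the diameter of connected undirected unweighted graphs with $m\geq 1$ edges that runs in time $O(m^{4/3-\delta})$. (Algorithms are deterministic programs of a random access machine, and the running time is measured by the logarithmic cost criterion, which agrees up to polylogarithmic factors with the word RAM with words of logarithmic length.) -/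

import Mathlib

/-! ## Machine model: a random access machine with logarithmic cost

The data of a machine are natural numbers, held in registers and in arrays with indirect
addressing. A program is a fixed finite piece of text. Every operation is charged the total bit
length of the numbers that it handles (logarithmic cost criterion), so that no running time
is saved by computing with long numbers. -/

namespace RAM

/-- Contents of the memory: registers `x`, and arrays `a` of unbounded length. -/
structure State where
  /-- `reg x` is the content of register `x`. -/
  reg : ℕ → ℕ
  /-- `arr a i` is the content of cell `i` of array `a`. -/
  arr : ℕ → ℕ → ℕ

/-- Arithmetic expressions; `get a e` reads array `a` at the address given by `e`. -/
inductive Expr where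
  | const (c : ℕ)
  | reg (x : ℕ)
  | get (a : ℕ) (e : Expr)
  | add (e₁ e₂ : Expr)
  | sub (e₁ e₂ : Expr)
  | mul (e₁ e₂ : Expr)
  | div (e₁ e₂ : Expr)
  | mod (e₁ e₂ : Expr)

namespace Expr

/-- Value of an expression. Subtraction is truncated at `0`; `x / 0 = 0` and `x % 0 = x`. -/
def eval (s : State) : Expr → ℕ
  | const c => c
  | reg x => s.reg x
  | get a e => s.arr a (e.eval s)
  | add e₁ e₂ => e₁.eval s + e₂.eval s
  | sub e₁ e₂ => e₁.eval s - e₂.eval s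
  | mul e₁ e₂ => e₁.eval s * e₂.eval s
  | div e₁ e₂ => e₁.eval s / e₂.eval s
  | mod e₁ e₂ => e₁.eval s % e₂.eval s

/-- Time for evaluating an expression: each node of the expression costs one plus the bit length
of its value. (The bit lengths of operands and addresses are charged at their own nodes.) -/
def cost (s : State) : Expr → ℕ
  | const c => 1 + Nat.size c
  | reg x => 1 + Nat.size (s.reg x)
  | get a e => e.cost s + (1 + Nat.size ((get a e).eval s))
  | add e₁ e₂ => e₁.cost s + e₂.cost s + (1 + Nat.size ((add e₁ e₂).eval s))
  | sub e₁ e₂ => e₁.cost s + e₂.cost s + (1 + Nat.size ((sub e₁ e₂).eval s))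
  | mul e₁ e₂ => e₁.cost s + e₂.cost s + (1 + Nat.size ((mul e₁ e₂).eval s))
  | div e₁ e₂ => e₁.cost s + e₂.cost s + (1 + Nat.size ((div e₁ e₂).eval s))
  | mod e₁ e₂ => e₁.cost s + e₂.cost s + (1 + Nat.size ((mod e₁ e₂).eval s))

end Expr

/-- Programs. -/
inductive Program where
  /-- Do nothing. -/
  | skip
  /-- Write the value of `e` to register `x`. -/
  | set (x : ℕ) (e : Expr)
  /-- Write the value of `e` to cell `i` of array `a`. -/
  | put (a : ℕ) (i e : Expr)
  /-- Run `p`, then `q`. -/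
  | seq (p q : Program)
  /-- Run `p` if the value of `b` is not `0`, and `q` if it is `0`. -/
  | branch (b : Expr) (p q : Program)
  /-- Run `p` again and again as long as the value of `b` is not `0`. -/
  | loop (b : Expr) (p : Program)

/-- `Exec p s s' t`: started in state `s`, the program `p` halts in state `s'` after time `t`. -/
inductive Exec : Program → State → State → ℕ → Prop where
  | skip (s : State) : Exec .skip s s 1
  | set (x : ℕ) (e : Expr) (s : State) :
      Exec (.set x e) s
        { s with reg := Function.update s.reg x (e.eval s) }
        (e.cost s + 1)
  | put (a : ℕ) (i e : Expr) (s : State) :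
      Exec (.put a i e) s
        { s with arr :=
            Function.update s.arr a (Function.update (s.arr a) (i.eval s) (e.eval s)) }
        (i.cost s + e.cost s + 1)
  | seq {p q : Program} {s s' s'' : State} {t t' : ℕ} :
      Exec p s s' t → Exec q s' s'' t' → Exec (.seq p q) s s'' (t + t')
  | branch_true {b : Expr} {p q : Program} {s s' : State} {t : ℕ} :
      b.eval s ≠ 0 → Exec p s s' t → Exec (.branch b p q) s s' (b.cost s + 1 + t)
  | branch_false {b : Expr} {p q : Program} {s s' : State} {t : ℕ} :
      b.eval s = 0 → Exec q s s' t → Exec (.branch b p q) s s' (b.cost s + 1 + t)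
  | loop_done {b : Expr} {p : Program} {s : State} :
      b.eval s = 0 → Exec (.loop b p) s s (b.cost s + 1)
  | loop_step {b : Expr} {p : Program} {s s' s'' : State} {t t' : ℕ} :
      b.eval s ≠ 0 → Exec p s s' t → Exec (.loop b p) s' s'' t' →
        Exec (.loop b p) s s'' (b.cost s + 1 + t + t')

/-- The start state on an input: the input stands at the beginning of array `0`, and every other
cell and all registers hold `0`. -/
def start (input : List ℕ) : State where
  reg := fun _ => 0
  arr := fun a i => if a = 0 then input.getD i 0 else 0

end RAM

/-! ## Satisfiability and the Strong Exponential Time Hypothesis -/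

/-- A CNF formula in the variables `0, …, n - 1`: a list of clauses, each a list of literals.
The literal `(v, true)` is the variable `v`, and `(v, false)` is its negation. -/
abbrev CNFFormula (n : ℕ) : Type := List (List (Fin n × Bool))

namespace CNFFormula

/-- Some assignment satisfies a literal of every clause. -/
def Satisfiable {n : ℕ} (φ : CNFFormula n) : Prop :=
  ∃ a : Fin n → Bool, ∀ C ∈ φ, ∃ l ∈ C, a l.1 = l.2

/-- The formula as an input: the numbers of variables and of clauses, then for each clause its
length and its literals, where `2 * v + 1` stands for the variable `v` and `2 * v` for its
negation. -/
def encode {n : ℕ} (φ : CNFFormula n) : List ℕ :=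
  n :: φ.length ::
    φ.flatMap fun C => C.length :: C.map fun l => 2 * (l.1 : ℕ) + (if l.2 then 1 else 0)

end CNFFormula

/-- The program `P` decides the satisfiability of CNF formulas with `n` variables and at most `c * n`
clauses in time `T n`. The answer is yes if register `0` is not `0` at the end. No clause repeats
a literal, so that the input length is polynomial in `n`. -/
def SolvesSparseCNFSat (P : RAM.Program) (c : ℕ) (T : ℕ → ℝ) : Prop :=
  ∀ (n : ℕ) (φ : CNFFormula n), (∀ C ∈ φ, C.Nodup) → φ.length ≤ c * n →
    ∃ (s : RAM.State) (t : ℕ), RAM.Exec P (RAM.start φ.encode) s t ∧ (t : ℝ) ≤ T n ∧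
      (s.reg 0 ≠ 0 ↔ φ.Satisfiable)

/-- Strong Exponential Time Hypothesis: CNF-SAT on `n` variables and `O(n)` clauses requires
time `2 ^ (n - o(n))`. That is, for every `δ > 0` there is a constant `c` such that no algorithm
decides CNF-SAT with `n` variables and at most `c * n` clauses in time `O(2 ^ ((1 - δ) * n))`. -/
def SETH : Prop :=
  ∀ δ : ℝ, 0 < δ → ∃ c : ℕ, ¬ ∃ (P : RAM.Program) (K : ℝ),
    SolvesSparseCNFSat P c fun n => K * (2 : ℝ) ^ ((1 - δ) * (n : ℝ))

/-! ## Approximating the diameter -/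

/-- `E` lists every edge of the graph `G` exactly once, in any order, with its end points in
either order. -/
def IsEdgeList {n : ℕ} (E : List (Fin n × Fin n)) (G : SimpleGraph (Fin n)) : Prop :=
  (E.map fun e => s(e.1, e.2)).Nodup ∧ ∀ u v, G.Adj u v ↔ s(u, v) ∈ E.map fun e => s(e.1, e.2)

/-- A graph as an input: the numbers of vertices and of edges, and the edges. -/
def encodeGraph {n : ℕ} (E : List (Fin n × Fin n)) : List ℕ :=
  n :: E.length :: E.flatMap fun e => [(e.1 : ℕ), (e.2 : ℕ)]

/-- The program `P` is an `α`-approximation algorithm for the diameter `D` of (simple, unweighted,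
undirected) connected graphs with `m ≥ 1` edges, of running time `T m`. Its output is the estimate
given by the quotient of registers `0` and `1`; it has to lie between `D / α` and `D`. -/
def ApproximatesDiameter (P : RAM.Program) (α : ℝ) (T : ℕ → ℝ) : Prop :=
  ∀ (n : ℕ) (G : SimpleGraph (Fin n)) (E : List (Fin n × Fin n)),
    G.Connected → IsEdgeList E G → 1 ≤ E.length →
      ∃ (s : RAM.State) (t : ℕ), RAM.Exec P (RAM.start (encodeGraph E)) s t ∧
        (t : ℝ) ≤ T E.length ∧ s.reg 1 ≠ 0 ∧
        (G.diam : ℝ) ≤ α * ((s.reg 0 : ℝ) / (s.reg 1 : ℝ)) ∧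
        (s.reg 0 : ℝ) / (s.reg 1 : ℝ) ≤ (G.diam : ℝ)

/-! ## The quadruple graph of a family of vectors -/

namespace QuadGraph

/-! The reduction starts from satisfiability and passes through orthogonality of four vectors. Split
the variables into four blocks and take one 0/1 vector for each partial assignment to a block. A
clause coordinate is one if the clause is left unsatisfied; four further coordinates are zero
exactly for the vectors of the corresponding block. Four vectors with no common one must come from
four different blocks, and together they form a satisfying assignment (`allMeet_vec`); conversely, a
satisfying assignment splits into such vectors (`exists_orthogonal`). Any three vectors miss a block
and hence share a one (`exists_vec_triple`). For linearly many clauses there are N = O(2^(n/4))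
vectors with d = O(n) coordinates.

The quadruple graph turns this into a gap between diameters 4 and 7. Its edges ask that vectors be
one at enough of five chosen coordinates. The thresholds are low enough that, if every four vectors
meet, one tuple of coordinates serves both of any two given vertices, and four steps join them
(`within_of_allMeet`). They are high enough for the pigeonhole principle on five positions, since 2
+ 4 and 3 + 3 exceed 5: if `a`, `b`, `c`, `d` are orthogonal, a vertex within distance three of both
`triple a b c` and `triple d c b` would yield a common one (`ball₃_disjoint`). So these two triples
are at distance at least 7.

The graph has at most 6 N^3 d^10 edges and is written down in time N^3 d^10 up to a logarithmic
factor (`build_run`). An estimate better than 7/4 separates 4 from 7 (`estimate_iff`), and time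
m^(4/3 - δ) becomes 2^((1 - δ')n) for some δ' > 0, against SETH. The reduction is an explicit
program, verified with the predicate `Run`: a common bound M on all numbers in memory reduces
logarithmic cost to a count of elementary operations times the bit length of M. -/

/-- Vertices: triples of vectors, and two copies of the pairs of vectors with five coordinates. -/
inductive Vertex (A J : Type) where
  | triple (a b c : A)
  | outer (a b : A) (x : Fin 5 → J)
  | inner (a b : A) (x : Fin 5 → J)

open Vertex

variable {A J : Type} (r : A → J → Bool)

/-- The number of positions of `x` at which all vectors of the list `l` have a one. -/
def count (l : List A) (x : Fin 5 → J) : ℕ :=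
  (Finset.univ.filter fun i => l.all fun a => r a (x i)).card

/-- The coordinates `x` fit the triple `a`, `b`, `c`. -/
def Fits (a b c : A) (x : Fin 5 → J) : Prop :=
  5 ≤ count r [a] x ∧ 3 ≤ count r [b] x ∧ 2 ≤ count r [b, c] x

/-- The oriented edges of the quadruple graph. -/
inductive Step : Vertex A J → Vertex A J → Prop where
  | pop (a b c : A) (x : Fin 5 → J) (h : Fits r a b c x) : Step (triple a b c) (outer a b x)
  | shiftOuter (a b : A) (x y : Fin 5 → J) : Step (outer a b x) (outer a b y)
  | enterLeft (a b c : A) (x : Fin 5 → J) (ha : 5 ≤ count r [a] x) (hb : 3 ≤ count r [b] x)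
      (hc : 4 ≤ count r [c] x) : Step (outer a b x) (inner a c x)
  | enterRight (a b c : A) (x : Fin 5 → J) (ha : 5 ≤ count r [a] x) (hb : 3 ≤ count r [b] x)
      (hc : 4 ≤ count r [c] x) : Step (outer a b x) (inner c a x)
  | shiftInner (a b : A) (x y : Fin 5 → J) : Step (inner a b x) (inner a b y)
  | swap (a b c : A) (x : Fin 5 → J) (ha : 4 ≤ count r [a] x) (hb : 4 ≤ count r [b] x)
      (hc : 5 ≤ count r [c] x) : Step (inner a b x) (inner c c x)

/-- The quadruple graph. -/
def graph : SimpleGraph (Vertex A J) := SimpleGraph.fromRel (Step r)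

variable {r}

/-- Pigeonhole: two sets of positions whose sizes sum to at least 6 intersect inside five positions.
Every contradiction in the lower bound comes from here. -/
theorem exists_of_count {l l' : List A} {x : Fin 5 → J} {p q : ℕ} (h : p ≤ count r l x)
    (h' : q ≤ count r l' x) (hpq : 6 ≤ p + q) :
    ∃ i, (∀ a ∈ l, r a (x i)) ∧ ∀ a ∈ l', r a (x i) := by
  obtain ⟨i, hi⟩ := Finset.inter_nonempty_of_card_lt_card_add_card
    (s := Finset.univ) (Finset.filter_subset (fun i => l.all fun a => r a (x i)) _)
    (Finset.filter_subset (fun i => l'.all fun a => r a (x i)) _)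
    (by simp only [count] at h h'; simp only [Finset.card_univ, Fintype.card_fin]; omega)
  simp only [Finset.mem_inter, Finset.mem_filter, List.all_eq_true] at hi
  exact ⟨i, hi.1.2, hi.2.2⟩

theorem forall_of_count {a : A} {x : Fin 5 → J} (h : 5 ≤ count r [a] x) (i : Fin 5) :
    r a (x i) := by
  have : (Finset.univ.filter fun i => [a].all fun a => r a (x i)) = Finset.univ :=
    Finset.eq_univ_of_card _ (le_antisymm (Finset.card_le_univ _) (by simpa [count] using h))
  simpa using this.ge (Finset.mem_univ i)

theorem le_count {l : List A} {x : Fin 5 → J} (s : Finset (Fin 5))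
    (h : ∀ i ∈ s, ∀ a ∈ l, r a (x i)) : s.card ≤ count r l x :=
  Finset.card_le_card fun i hi => by simpa using h i hi

/-! ### Vectors that pairwise overlap: small distances -/

/-- Any four vectors have a common one. -/
def AllMeet (r : A → J → Bool) : Prop := ∀ a b c d, ∃ j, r a j ∧ r b j ∧ r c j ∧ r d j

/-- `u` and `v` are equal or adjacent. -/
def Near (r : A → J → Bool) (u v : Vertex A J) : Prop := u = v ∨ (graph r).Adj u v

theorem Near.symm {u v : Vertex A J} (h : Near r u v) : Near r v u :=
  h.imp Eq.symm SimpleGraph.Adj.symm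

theorem Near.of_step {u v : Vertex A J} (h : Step r u v) : Near r u v := by
  by_cases e : u = v
  · exact .inl e
  · exact .inr ⟨e, .inl h⟩

theorem Near.edist_le {u v : Vertex A J} (h : Near r u v) : (graph r).edist u v ≤ 1 :=
  SimpleGraph.edist_le_one_iff_adj_or_eq.2 (Or.symm h)

theorem Near.reachable {u v : Vertex A J} (h : Near r u v) : (graph r).Reachable u v := by
  rcases h with rfl | h
  · exact .rfl
  · exact h.reachable

/-- `u` is at distance at most four from `v`. -/
def Within (r : A → J → Bool) (u v : Vertex A J) : Prop :=
  ∃ w₁ w₂ w₃, Near r u w₁ ∧ Near r w₁ w₂ ∧ Near r w₂ w₃ ∧ Near r w₃ v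

theorem Within.symm {u v : Vertex A J} (h : Within r u v) : Within r v u := by
  obtain ⟨w₁, w₂, w₃, h₁, h₂, h₃, h₄⟩ := h
  exact ⟨w₃, w₂, w₁, h₄.symm, h₃.symm, h₂.symm, h₁.symm⟩

theorem Within.edist_le {u v : Vertex A J} (h : Within r u v) : (graph r).edist u v ≤ 4 := by
  obtain ⟨w₁, w₂, w₃, h₁, h₂, h₃, h₄⟩ := h
  calc (graph r).edist u v ≤ (graph r).edist u w₁ + (graph r).edist w₁ v :=
        SimpleGraph.edist_triangle
    _ ≤ (graph r).edist u w₁ + ((graph r).edist w₁ w₂ + (graph r).edist w₂ v) := by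
        gcongr; exact SimpleGraph.edist_triangle
    _ ≤ (graph r).edist u w₁ + ((graph r).edist w₁ w₂ +
          ((graph r).edist w₂ w₃ + (graph r).edist w₃ v)) := by
        gcongr; exact SimpleGraph.edist_triangle
    _ ≤ 1 + (1 + (1 + 1)) := by
        gcongr
        exacts [h₁.edist_le, h₂.edist_le, h₃.edist_le, h₄.edist_le]
    _ = 4 := by norm_num

theorem exists_fits_fits (h : AllMeet r) (a b c d e f : A) :
    ∃ x, Fits r a b c x ∧ Fits r d e f x := by
  obtain ⟨p, hp⟩ := h a b c d
  obtain ⟨q, hq⟩ := h a b d e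
  obtain ⟨s, hs⟩ := h a d e f
  -- `a` and `d` are one everywhere. The positions required of `b` (0, 1, 2) and of `e` (2, 3, 4)
  -- overlap only at `q`, where neither `c` nor `f` is needed, so no position asks for more than
  -- four vectors.
  refine ⟨![p, p, q, s, s], ⟨le_count {0, 1, 2, 3, 4} ?_, le_count {0, 1, 2} ?_,
    le_count {0, 1} ?_⟩, le_count {0, 1, 2, 3, 4} ?_, le_count {2, 3, 4} ?_,
    le_count {3, 4} ?_⟩ <;> simp [hp, hq, hs]

theorem exists_fits_inner (h : AllMeet r) (a b d e f : A) :
    ∃ x, (4 ≤ count r [a] x ∧ 4 ≤ count r [b] x) ∧ Fits r d e f x := by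
  obtain ⟨p, hp⟩ := h a d e f
  obtain ⟨q, hq⟩ := h b d e f
  obtain ⟨s, hs⟩ := h a b d e
  -- `a` may fail only at position 1 and `b` only at position 0; `f` is needed just at these two.
  refine ⟨![p, q, s, s, s], ⟨le_count {0, 2, 3, 4} ?_, le_count {1, 2, 3, 4} ?_⟩,
    le_count {0, 1, 2, 3, 4} ?_, le_count {2, 3, 4} ?_, le_count {0, 1} ?_⟩ <;>
    simp [hp, hq, hs]

theorem le_count_const {j : J} {l : List A} (h : ∀ a ∈ l, r a j) {k : ℕ} (hk : k ≤ 5) :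
    k ≤ count r l fun _ => j :=
  hk.trans (le_count Finset.univ fun _ _ => h)

/-- Every vertex reaches a pair of one of the two kinds, with any fitting coordinates. -/
theorem near_pair (u : Vertex A J) :
    (∃ a b c, ∀ x, Fits r a b c x → Near r u (outer a b x)) ∨
      ∃ a b, ∀ x, Near r u (inner a b x) := by
  match u with
  | triple a b c => exact .inl ⟨a, b, c, fun x h => .of_step (.pop a b c x h)⟩
  | outer a b x => exact .inl ⟨a, b, b, fun y _ => .of_step (.shiftOuter a b x y)⟩
  | Vertex.inner a b x => exact .inr ⟨a, b, fun y => .of_step (.shiftInner a b x y)⟩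

/-- The first step from either end goes to a pair carrying a common tuple; two more steps join the
pairs. Two `outer` pairs are joined through `inner a d x`, an `inner` and an `outer` pair through
`inner d d x`, and two `inner` pairs through `inner a a` with a constant tuple. -/
theorem within_of_allMeet (h : AllMeet r) (u v : Vertex A J) : Within r u v := by
  have key : ∀ u v : Vertex A J, (∃ a b, ∀ x, Near r u (inner a b x)) →
      (∃ a b c, ∀ x, Fits r a b c x → Near r v (outer a b x)) → Within r u v := by
    rintro u v ⟨a, b, hu⟩ ⟨d, e, f, hv⟩
    obtain ⟨x, ⟨ha, hb⟩, hd⟩ := exists_fits_inner h a b d e f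
    exact ⟨_, inner d d x, _, hu x, .of_step (.swap a b d x ha hb hd.1),
      (Near.of_step (.enterLeft d e d x hd.1 hd.2.1 (by have := hd.1; omega))).symm,
      (hv x hd).symm⟩
  rcases near_pair (r := r) u with hu | hu <;> rcases near_pair (r := r) v with hv | hv
  · obtain ⟨a, b, c, hu⟩ := hu
    obtain ⟨d, e, f, hv⟩ := hv
    obtain ⟨x, ha, hd⟩ := exists_fits_fits h a b c d e f
    exact ⟨_, inner a d x, _, hu x ha,
      .of_step (.enterLeft a b d x ha.1 ha.2.1 (by have := hd.1; omega)),
      (Near.of_step (.enterRight d e a x hd.1 hd.2.1 (by have := ha.1; omega))).symm,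
      (hv x hd).symm⟩
  · exact (key v u hv hu).symm
  · exact key u v hu hv
  · obtain ⟨a, b, hu⟩ := hu
    obtain ⟨d, e, hv⟩ := hv
    obtain ⟨j, ha, hb, hd, he⟩ := h a b d e
    exact ⟨_, inner a a fun _ => j, _, hu _,
      .of_step (.swap _ _ _ _ (le_count_const (by simpa) (by decide))
        (le_count_const (by simpa) (by decide)) (le_count_const (by simpa) le_rfl)),
      (Near.of_step (.swap _ _ _ _ (le_count_const (by simpa) (by decide))
        (le_count_const (by simpa) (by decide)) (le_count_const (by simpa) le_rfl))).symm,
      (hv _).symm⟩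

theorem ediam_le_of_allMeet (h : AllMeet r) : (graph r).ediam ≤ 4 :=
  SimpleGraph.ediam_le_of_edist_le fun u v => (within_of_allMeet h u v).edist_le

/-! ### Connectedness -/

/-- A constant tuple at a common one meets every threshold. Only three vectors occur at a time, so
connectedness does not need four of them to meet and holds for satisfiable formulas too. -/
theorem connected [Nonempty A] [Nonempty J] (h : ∀ a b c, ∃ j, r a j ∧ r b j ∧ r c j) :
    (graph r).Connected := by
  obtain ⟨o⟩ := ‹Nonempty A›
  obtain ⟨j₀⟩ := ‹Nonempty J›
  have inn : ∀ a b x, (graph r).Reachable (inner a b x) (inner o o fun _ => j₀) := by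
    intro a b x
    obtain ⟨j, ha, hb, ho⟩ := h a b o
    exact (Near.of_step (.shiftInner a b x fun _ => j)).reachable.trans
      ((Near.of_step (.swap a b o _ (le_count_const (by simpa) (by decide))
        (le_count_const (by simpa) (by decide)) (le_count_const (by simpa) le_rfl))).reachable.trans
      (Near.of_step (.shiftInner o o _ _)).reachable)
  have out : ∀ a b x, (graph r).Reachable (outer a b x) (inner o o fun _ => j₀) := by
    intro a b x
    obtain ⟨j, ha, hb, -⟩ := h a b o
    exact (Near.of_step (.shiftOuter a b x fun _ => j)).reachable.trans
      ((Near.of_step (.enterLeft a b a _ (le_count_const (by simpa) le_rfl)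
        (le_count_const (by simpa) (by decide))
        (le_count_const (by simpa) (by decide)))).reachable.trans (inn _ _ _))
  have all : ∀ u, (graph r).Reachable u (inner o o fun _ => j₀) := by
    rintro (⟨a, b, c⟩ | ⟨a, b, x⟩ | ⟨a, b, x⟩)
    · obtain ⟨j, ha, hb, hc⟩ := h a b c
      exact (Near.of_step (.pop a b c _ ⟨le_count_const (by simpa) le_rfl,
        le_count_const (by simpa) (by decide),
        le_count_const (by simpa using ⟨hb, hc⟩) (by decide)⟩)).reachable.trans
          (out a b fun _ => j)
    · exact out a b x
    · exact inn a b x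
  have : Nonempty (Vertex A J) := ⟨inner o o fun _ => j₀⟩
  exact ⟨fun u v => (all u).trans (all v).symm⟩

/-! ### Orthogonal vectors: a large distance -/

/-- The vertices at distance at most one from `triple a b c`. -/
inductive Ball₁ (r : A → J → Bool) (a b c : A) : Vertex A J → Prop where
  | self : Ball₁ r a b c (triple a b c)
  | outer (x : Fin 5 → J) (h : Fits r a b c x) : Ball₁ r a b c (outer a b x)

/-- Holds for the vertices at distance at most two from `triple a b c`. -/
inductive Ball₂ (r : A → J → Bool) (a b c : A) : Vertex A J → Prop where
  | triple (c' : A) : Ball₂ r a b c (triple a b c')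
  | outer (x : Fin 5 → J) : Ball₂ r a b c (outer a b x)
  | inner (p q : A) (x : Fin 5 → J) (h : Fits r a b c x) (hp : 4 ≤ count r [p] x)
      (hq : 4 ≤ count r [q] x) (ha : p = a ∨ q = a) : Ball₂ r a b c (inner p q x)

/-- Holds for the vertices at distance at most three from `triple a b c`. -/
inductive Ball₃ (r : A → J → Bool) (a b c : A) : Vertex A J → Prop where
  | triple (c' : A) : Ball₃ r a b c (triple a b c')
  | outer (x : Fin 5 → J) : Ball₃ r a b c (outer a b x)
  | outerFar (d e : A) (x : Fin 5 → J) (h : Fits r a b c x) (hd : 5 ≤ count r [d] x) :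
      Ball₃ r a b c (outer d e x)
  | inner (p q : A) (x : Fin 5 → J) (h : 5 ≤ count r [a] x) (hb : 3 ≤ count r [b] x)
      (ha : p = a ∨ q = a) : Ball₃ r a b c (inner p q x)
  | innerShift (p q : A) (x y : Fin 5 → J) (h : Fits r a b c y) (hp : 4 ≤ count r [p] y)
      (hq : 4 ≤ count r [q] y) (ha : p = a ∨ q = a) : Ball₃ r a b c (inner p q x)
  | innerFar (p q : A) (x : Fin 5 → J) (h : Fits r a b c x) (hp : 4 ≤ count r [p] x)
      (hq : 4 ≤ count r [q] x) : Ball₃ r a b c (inner p q x)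

theorem Ball₁.ball₂ {a b c : A} {u : Vertex A J} (h : Ball₁ r a b c u) : Ball₂ r a b c u := by
  cases h
  exacts [.triple c, .outer _]

theorem Ball₂.ball₃ {a b c : A} {u : Vertex A J} (h : Ball₂ r a b c u) : Ball₃ r a b c u := by
  cases h with
  | triple c' => exact .triple c'
  | outer x => exact .outer x
  | inner p q x h hp hq ha => exact .innerFar p q x h hp hq

theorem Near.ball₁ {a b c : A} {v : Vertex A J} (h : Near r (triple a b c) v) :
    Ball₁ r a b c v := by
  rcases h with rfl | ⟨-, h | h⟩
  · exact .self
  · cases h with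
    | pop _ _ _ x h => exact .outer x h
  · cases h

theorem Near.ball₂ {a b c : A} {u v : Vertex A J} (hu : Ball₁ r a b c u) (h : Near r u v) :
    Ball₂ r a b c v := by
  rcases h with rfl | ⟨-, h | h⟩
  · exact hu.ball₂
  · cases hu with
    | self =>
      cases h with
      | pop => exact .outer _
    | outer x hx =>
      cases h with
      | shiftOuter => exact .outer _
      | enterLeft _ _ d _ ha _ hd => exact .inner _ _ _ hx (by omega) hd (.inl rfl)
      | enterRight _ _ d _ ha _ hd => exact .inner _ _ _ hx hd (by omega) (.inr rfl)
  · cases hu with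
    | self => cases h
    | outer x hx =>
      cases h with
      | shiftOuter => exact .outer _
      | pop => exact .triple _

/-- The third step may lose information, but only in part. From an `inner` vertex either the tuple
changes and `a` stays in the pair, or `a` may leave while the fitting tuple stays. Entering `inner`
from a shifted `outer` vertex guarantees only the thresholds on `a` and `b`. -/
theorem Near.ball₃ {a b c : A} {u v : Vertex A J} (hu : Ball₂ r a b c u) (h : Near r u v) :
    Ball₃ r a b c v := by
  rcases h with rfl | ⟨-, h | h⟩
  · exact hu.ball₃
  · cases hu with
    | triple =>
      cases h with
      | pop => exact .outer _
    | outer x =>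
      cases h with
      | shiftOuter => exact .outer _
      | enterLeft _ _ d _ ha hb hd => exact .inner _ _ _ ha hb (.inl rfl)
      | enterRight _ _ d _ ha hb hd => exact .inner _ _ _ ha hb (.inr rfl)
    | inner p q x hx hp hq ha =>
      cases h with
      | shiftInner _ _ _ y => exact .innerShift _ _ _ x hx hp hq ha
      | swap _ _ d _ _ _ hd => exact .innerFar _ _ _ hx (by omega) (by omega)
  · cases hu with
    | triple => cases h
    | outer x =>
      cases h with
      | shiftOuter => exact .outer _
      | pop => exact .triple _
    | inner p q x hx hp hq ha =>
      cases h with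
      | shiftInner _ _ _ y => exact .innerShift _ _ _ x hx hp hq ha
      | swap _ _ _ _ hp' hq' => exact .innerFar _ _ _ hx hp' hq'
      | enterLeft _ _ d _ hd => exact .outerFar _ _ _ hx hd
      | enterRight _ _ d _ hd => exact .outerFar _ _ _ hx hd

/-- A tuple fitting one centre cannot have the first vector of the other centre at four positions (2
+ 4 > 5), by `F₁` and `F₂`. If both sides know only the weaker thresholds, `b` and `c` still collide
(3 + 3 > 5), by `F₃`. -/
theorem ball₃_disjoint {a b c d : A} (horth : ∀ j, ¬ (r a j ∧ r b j ∧ r c j ∧ r d j))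
    (had : a ≠ d) {u : Vertex A J} (hs : Ball₃ r a b c u) (ht : Ball₃ r d c b u) : False := by
  have F₁ : ∀ x, Fits r a b c x → ¬ 4 ≤ count r [d] x := by
    intro x hx hd
    obtain ⟨i, h₁, h₂⟩ := exists_of_count hx.2.2 hd (by norm_num)
    simp only [List.mem_cons, List.not_mem_nil, or_false, forall_eq_or_imp, forall_eq] at h₁ h₂
    exact horth _ ⟨forall_of_count hx.1 i, h₁.1, h₁.2, h₂⟩
  have F₂ : ∀ x, Fits r d c b x → ¬ 4 ≤ count r [a] x := by
    intro x hx hd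
    obtain ⟨i, h₁, h₂⟩ := exists_of_count hx.2.2 hd (by norm_num)
    simp only [List.mem_cons, List.not_mem_nil, or_false, forall_eq_or_imp, forall_eq] at h₁ h₂
    exact horth _ ⟨h₂, h₁.2, h₁.1, forall_of_count hx.1 i⟩
  have F₃ : ∀ x, 5 ≤ count r [a] x → 3 ≤ count r [b] x → 5 ≤ count r [d] x →
      ¬ 3 ≤ count r [c] x := by
    intro x ha hb hd hc
    obtain ⟨i, h₁, h₂⟩ := exists_of_count hb hc (by norm_num)
    simp only [List.mem_cons, List.not_mem_nil, or_false, forall_eq] at h₁ h₂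
    exact horth _ ⟨forall_of_count ha i, h₁, h₂, forall_of_count hd i⟩
  have F₄ : ∀ {k k' : ℕ}, k ≤ k' → ∀ {e x}, k' ≤ count r [e] x → k ≤ count r [e] x :=
    fun h _ _ h' => h.trans h'
  have h₄₅ : 4 ≤ 5 := by norm_num
  cases hs with
  | triple => cases ht; exact had rfl
  | outer x =>
    cases ht with
    | outer => exact had rfl
    | outerFar _ _ _ h hd => exact F₂ _ h (F₄ h₄₅ hd)
  | outerFar _ _ x h hd =>
    cases ht with
    | outer => exact F₁ _ h (F₄ h₄₅ hd)
    | outerFar _ _ _ h' hd' => exact F₁ _ h (F₄ h₄₅ h'.1)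
  | inner p q x h hb ha =>
    cases ht with
    | inner _ _ _ h' hb' ha' => exact F₃ _ h hb h' hb'
    | innerShift _ _ _ y hy hp hq =>
      rcases ha with rfl | rfl
      exacts [F₂ _ hy hp, F₂ _ hy hq]
    | innerFar _ _ _ hy hp hq =>
      rcases ha with rfl | rfl
      exacts [F₂ _ hy hp, F₂ _ hy hq]
  -- The tuple of the common vertex is arbitrary here; the contradiction is drawn at the fitting
  -- tuple before a shift, where both vectors of the pair have at least four ones.
  | innerShift p q x z hz hp hq ha =>
    cases ht with
    | inner _ _ _ h' hb' ha' =>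
      rcases ha' with rfl | rfl
      exacts [F₁ _ hz hp, F₁ _ hz hq]
    | innerShift _ _ _ y hy hp' hq' =>
      rcases ha with rfl | rfl
      exacts [F₂ _ hy hp', F₂ _ hy hq']
    | innerFar _ _ _ hy hp' hq' =>
      rcases ha with rfl | rfl
      exacts [F₂ _ hy hp', F₂ _ hy hq']
  | innerFar p q x hx hp hq =>
    cases ht with
    | inner _ _ _ h' hb' ha' =>
      rcases ha' with rfl | rfl
      exacts [F₁ _ hx hp, F₁ _ hx hq]
    | innerShift _ _ _ y hy hp' hq' ha' =>
      rcases ha' with rfl | rfl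
      exacts [F₁ _ hx hp, F₁ _ hx hq]
    | innerFar _ _ _ hy hp' hq' => exact F₁ _ hx (F₄ h₄₅ hy.1)

theorem seven_le_ediam (h : ∀ a b c, ∃ j, r a j ∧ r b j ∧ r c j) {a b c d : A}
    (horth : ∀ j, ¬ (r a j ∧ r b j ∧ r c j ∧ r d j)) : 7 ≤ (graph r).ediam := by
  have had : a ≠ d := by
    rintro rfl
    obtain ⟨j, h₁, h₂, h₃⟩ := h a b c
    exact horth j ⟨h₁, h₂, h₃, h₁⟩
  refine le_trans ?_ (SimpleGraph.edist_le_ediam (u := triple a b c) (v := triple d c b))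
  by_contra! hlt
  obtain ⟨w, hw⟩ := SimpleGraph.exists_walk_of_edist_ne_top (ne_top_of_lt hlt)
  have hlen : w.length ≤ 6 := by
    rw [← hw] at hlt
    have : w.length < 7 := by exact_mod_cast hlt
    omega
  -- `getVert` stays at the end point beyond the length, so a shorter walk counts as six steps with
  -- repetitions, and vertex 3 lies in both balls.
  have near : ∀ i, Near r (w.getVert i) (w.getVert (i + 1)) := by
    intro i
    by_cases hi : i < w.length
    · exact .inr (w.adj_getVert_succ hi)
    · rw [w.getVert_of_length_le (by omega), w.getVert_of_length_le (by omega)]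
      exact .inl rfl
  have h₀ := near 0
  rw [w.getVert_zero] at h₀
  have h₅ := (near 5).symm
  rw [w.getVert_of_length_le hlen] at h₅
  exact ball₃_disjoint horth had (Near.ball₃ (Near.ball₂ h₀.ball₁ (near 1)) (near 2))
    (Near.ball₃ (Near.ball₂ h₅.ball₁ (near 4).symm) (near 3).symm)

end QuadGraph

/-! ## Program logic for the random access machine -/

namespace RAM

/-! ### Moving a program to higher registers and arrays -/

/-- The expression with `k` added to the numbers of all registers and arrays. -/
def Expr.shift (k : ℕ) : Expr → Expr
  | const c => const c
  | reg x => reg (x + k)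
  | get a e => get (a + k) (e.shift k)
  | add e₁ e₂ => add (e₁.shift k) (e₂.shift k)
  | sub e₁ e₂ => sub (e₁.shift k) (e₂.shift k)
  | mul e₁ e₂ => mul (e₁.shift k) (e₂.shift k)
  | div e₁ e₂ => div (e₁.shift k) (e₂.shift k)
  | mod e₁ e₂ => mod (e₁.shift k) (e₂.shift k)

/-- The program with `k` added to the numbers of all registers and arrays. -/
def Program.shift (k : ℕ) : Program → Program
  | skip => skip
  | set x e => set (x + k) (e.shift k)
  | put a i e => put (a + k) (i.shift k) (e.shift k)
  | seq p q => seq (p.shift k) (q.shift k)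
  | branch b p q => branch (b.shift k) (p.shift k) (q.shift k)
  | loop b p => loop (b.shift k) (p.shift k)

/-- The part of the memory that a program shifted by `k` works on. -/
def State.upper (k : ℕ) (s : State) : State where
  reg x := s.reg (x + k)
  arr a := s.arr (a + k)

theorem Expr.eval_shift (k : ℕ) (s : State) (e : Expr) :
    (e.shift k).eval s = e.eval (s.upper k) := by
  induction e <;> simp_all [Expr.shift, Expr.eval, State.upper]

theorem Expr.cost_shift (k : ℕ) (s : State) (e : Expr) :
    (e.shift k).cost s = e.cost (s.upper k) := by
  have h := fun e => Expr.eval_shift k s e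
  induction e <;>
    simp_all [Expr.shift, Expr.cost, State.upper, Expr.eval]

/-- This lets an unknown program run as a subroutine: it sees a fresh memory above `k`, whatever
lies below, and takes exactly the same time. -/
theorem Exec.shift {k : ℕ} {p : Program} {s s' : State} {t : ℕ} (h : Exec p s s' t) :
    ∀ S : State, S.upper k = s → ∃ S' : State, S'.upper k = s' ∧ Exec (p.shift k) S S' t := by
  induction h with
  | skip s => exact fun S h => ⟨S, h, .skip S⟩
  | set x e s =>
    rintro S rfl
    have h := Exec.set (x + k) (e.shift k) S
    rw [Expr.cost_shift] at h
    refine ⟨_, ?_, h⟩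
    simp only [State.upper, State.mk.injEq, and_true, Expr.eval_shift]
    funext y
    simp [Function.update_apply]
  | put a i e s =>
    rintro S rfl
    have h := Exec.put (a + k) (i.shift k) (e.shift k) S
    rw [Expr.cost_shift, Expr.cost_shift] at h
    refine ⟨_, ?_, h⟩
    simp only [State.upper, State.mk.injEq, true_and, Expr.eval_shift]
    funext y
    simp [Function.update_apply]
  | seq _ _ ih₁ ih₂ =>
    intro S h
    obtain ⟨S₁, h₁, e₁⟩ := ih₁ S h
    obtain ⟨S₂, h₂, e₂⟩ := ih₂ S₁ h₁
    exact ⟨S₂, h₂, .seq e₁ e₂⟩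
  | branch_true hb _ ih =>
    rintro S rfl
    obtain ⟨S₁, h₁, e₁⟩ := ih S rfl
    refine ⟨S₁, h₁, ?_⟩
    rw [← Expr.cost_shift]
    exact .branch_true (by rwa [Expr.eval_shift]) e₁
  | branch_false hb _ ih =>
    rintro S rfl
    obtain ⟨S₁, h₁, e₁⟩ := ih S rfl
    refine ⟨S₁, h₁, ?_⟩
    rw [← Expr.cost_shift]
    exact .branch_false (by rwa [Expr.eval_shift]) e₁
  | loop_done hb =>
    rintro S rfl
    refine ⟨S, rfl, ?_⟩
    rw [← Expr.cost_shift]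
    exact .loop_done (by rwa [Expr.eval_shift])
  | loop_step hb _ _ ih₁ ih₂ =>
    rintro S rfl
    obtain ⟨S₁, h₁, e₁⟩ := ih₁ S rfl
    obtain ⟨S₂, h₂, e₂⟩ := ih₂ S₁ h₁
    refine ⟨S₂, h₂, ?_⟩
    rw [← Expr.cost_shift]
    exact .loop_step (by rwa [Expr.eval_shift]) e₁ e₂

/-! ### Bounded memory -/

/-- All numbers in the memory are at most `M`. -/
structure State.Bounded (M : ℕ) (s : State) : Prop where
  two_le : 2 ≤ M
  reg_le (x : ℕ) : s.reg x ≤ M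
  arr_le (a i : ℕ) : s.arr a i ≤ M

/-- The value of an expression is at most this power of a bound for the memory. -/
def Expr.weight : Expr → ℕ
  | const c => c + 1
  | reg _ => 1
  | get _ e => e.weight + 1
  | add e₁ e₂ => e₁.weight + e₂.weight
  | sub e₁ e₂ => e₁.weight + e₂.weight
  | mul e₁ e₂ => e₁.weight + e₂.weight
  | div e₁ e₂ => e₁.weight + e₂.weight
  | mod e₁ e₂ => e₁.weight + e₂.weight

/-- Factor in the bound `Expr.cost_le` for the time of an evaluation. -/
def Expr.charge : Expr → ℕ
  | const c => 1 + (const c).weight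
  | reg x => 1 + (reg x).weight
  | get a e => e.charge + (1 + (get a e).weight)
  | add e₁ e₂ => e₁.charge + e₂.charge + (1 + (add e₁ e₂).weight)
  | sub e₁ e₂ => e₁.charge + e₂.charge + (1 + (sub e₁ e₂).weight)
  | mul e₁ e₂ => e₁.charge + e₂.charge + (1 + (mul e₁ e₂).weight)
  | div e₁ e₂ => e₁.charge + e₂.charge + (1 + (div e₁ e₂).weight)
  | mod e₁ e₂ => e₁.charge + e₂.charge + (1 + (mod e₁ e₂).weight)

theorem Expr.one_le_weight (e : Expr) : 1 ≤ e.weight := by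
  induction e <;> simp only [Expr.weight] <;> omega

/-- A product of two numbers that are at least 2 bounds their sum; this is why `Bounded` demands `2
≤ M`. -/
theorem add_le_pow {M a b p q : ℕ} (hM : 2 ≤ M) (hp : 1 ≤ p) (hq : 1 ≤ q) (ha : a ≤ M ^ p)
    (hb : b ≤ M ^ q) : a + b ≤ M ^ (p + q) := by
  have h₁ : 2 ≤ M ^ p := hM.trans (Nat.le_self_pow (by omega) M)
  have h₂ : 2 ≤ M ^ q := hM.trans (Nat.le_self_pow (by omega) M)
  rw [pow_add]
  nlinarith

theorem Expr.eval_le {M : ℕ} {s : State} (h : s.Bounded M) (e : Expr) :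
    e.eval s ≤ M ^ e.weight := by
  have h₁ : 1 ≤ M := le_trans (by norm_num) h.two_le
  have left : ∀ p q, M ^ p ≤ M ^ (p + q) := fun p q => Nat.pow_le_pow_right h₁ (by omega)
  induction e with
  | const c =>
    calc c ≤ 2 ^ (c + 1) := (Nat.lt_two_pow_self.le).trans (Nat.pow_le_pow_right (by norm_num)
            (by omega))
      _ ≤ M ^ (c + 1) := Nat.pow_le_pow_left h.two_le _
  | reg x => simpa [Expr.eval, Expr.weight] using h.reg_le x
  | get a e _ => exact (h.arr_le a _).trans (Nat.le_self_pow (by simp [Expr.weight]) M)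
  | add e₁ e₂ ih₁ ih₂ =>
    exact add_le_pow h.two_le e₁.one_le_weight e₂.one_le_weight ih₁ ih₂
  | sub e₁ e₂ ih₁ ih₂ => exact (Nat.sub_le _ _).trans (ih₁.trans (left _ _))
  | mul e₁ e₂ ih₁ ih₂ =>
    rw [Expr.eval, Expr.weight, pow_add]
    exact Nat.mul_le_mul ih₁ ih₂
  | div e₁ e₂ ih₁ ih₂ => exact (Nat.div_le_self _ _).trans (ih₁.trans (left _ _))
  | mod e₁ e₂ ih₁ ih₂ => exact (Nat.mod_le _ _).trans (ih₁.trans (left _ _))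

theorem size_pow_le (M k : ℕ) (hk : 1 ≤ k) : Nat.size (M ^ k) ≤ k * Nat.size M := by
  rw [Nat.size_le, mul_comm, pow_mul]
  exact Nat.pow_lt_pow_left (Nat.lt_size_self M) (by omega)

theorem Expr.node_le {M : ℕ} {s : State} (h : s.Bounded M) (e : Expr) :
    1 + Nat.size (e.eval s) ≤ (1 + e.weight) * (Nat.size M + 1) := by
  have h₁ := (Nat.size_le_size (e.eval_le h)).trans (size_pow_le M _ e.one_le_weight)
  nlinarith

/-- Each node has a value at most a fixed power of `M`, so its bit length is a fixed multiple of
that of `M`. -/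
theorem Expr.cost_le {M : ℕ} {s : State} (h : s.Bounded M) (e : Expr) :
    e.cost s ≤ e.charge * (Nat.size M + 1) := by
  induction e with
  | const c => exact Expr.node_le h (const c)
  | reg x => exact Expr.node_le h (reg x)
  | get a e ih => rw [Expr.cost, Expr.charge, add_mul]; exact add_le_add ih (Expr.node_le h _)
  | add e₁ e₂ ih₁ ih₂ | sub e₁ e₂ ih₁ ih₂ | mul e₁ e₂ ih₁ ih₂ | div e₁ e₂ ih₁ ih₂
  | mod e₁ e₂ ih₁ ih₂ =>
    rw [Expr.cost, Expr.charge, add_mul, add_mul]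
    exact add_le_add (add_le_add ih₁ ih₂) (Expr.node_le h _)

/-! ### Total correctness with running time -/

/-- The state after writing `v` to register `x`. -/
def State.setReg (s : State) (x v : ℕ) : State :=
  { s with reg := Function.update s.reg x v }

/-- The state after writing `v` to cell `i` of array `a`. -/
def State.setArr (s : State) (a i v : ℕ) : State :=
  { s with arr := Function.update s.arr a (Function.update (s.arr a) i v) }

@[simp] theorem State.setReg_reg (s : State) (x v y : ℕ) :
    (s.setReg x v).reg y = if y = x then v else s.reg y := Function.update_apply ..

@[simp] theorem State.setReg_arr (s : State) (x v : ℕ) : (s.setReg x v).arr = s.arr := rfl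

@[simp] theorem State.setArr_reg (s : State) (a i v : ℕ) : (s.setArr a i v).reg = s.reg := rfl

@[simp] theorem State.setArr_arr (s : State) (a i v b : ℕ) :
    (s.setArr a i v).arr b = if b = a then Function.update (s.arr b) i v else s.arr b := by
  simp only [State.setArr, Function.update_apply]
  split_ifs with h
  · rw [h]
  · rfl

theorem State.Bounded.setReg {M : ℕ} {s : State} (h : s.Bounded M) {x v : ℕ} (hv : v ≤ M) :
    (s.setReg x v).Bounded M where
  two_le := h.two_le
  reg_le y := by rw [State.setReg_reg]; split_ifs; exacts [hv, h.reg_le y]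
  arr_le := h.arr_le

theorem State.Bounded.setArr {M : ℕ} {s : State} (h : s.Bounded M) {a i v : ℕ} (hv : v ≤ M) :
    (s.setArr a i v).Bounded M where
  two_le := h.two_le
  reg_le := h.reg_le
  arr_le b j := by
    rw [State.setArr_arr]
    split_ifs
    · rw [Function.update_apply]; split_ifs; exacts [hv, h.arr_le b j]
    · exact h.arr_le b j

/-- Started in `s`, the program `p` halts after at most `c * (Nat.size M + 1)` steps, in a state
that is bounded by `M` and satisfies `Q`. -/
def Run (M : ℕ) (p : Program) (s : State) (c : ℕ) (Q : State → Prop) : Prop :=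
  ∃ s' t, Exec p s s' t ∧ t ≤ c * (Nat.size M + 1) ∧ s'.Bounded M ∧ Q s'

/-- Running time of loop-free programs, in units of `Nat.size M + 1`. -/
def Program.charge : Program → ℕ
  | skip => 1
  | set _ e => e.charge + 1
  | put _ i e => i.charge + e.charge + 1
  | seq p q => p.charge + q.charge
  | branch b p q => b.charge + 1 + (p.charge + q.charge)
  | loop _ _ => 0

variable {M : ℕ} {p q : Program} {s : State} {Q R : State → Prop} {c c₁ c₂ : ℕ}

theorem Run.mono (h : Run M p s c₁ Q) (hc : c₁ ≤ c₂) (hQ : ∀ s, s.Bounded M → Q s → R s) :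
    Run M p s c₂ R := by
  obtain ⟨s', t, h₁, h₂, h₃, h₄⟩ := h
  exact ⟨s', t, h₁, h₂.trans (Nat.mul_le_mul_right _ hc), h₃, hQ _ h₃ h₄⟩

theorem Run.skip (hs : s.Bounded M) (h : Q s) : Run M .skip s Program.skip.charge Q :=
  ⟨s, 1, .skip s, by simp [Program.charge], hs, h⟩

theorem Run.set {x v : ℕ} {e : Expr} (hs : s.Bounded M) (he : e.eval s = v) (hv : v ≤ M)
    (h : (s.setReg x v).Bounded M → Q (s.setReg x v)) :
    Run M (.set x e) s (Program.set x e).charge Q := by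
  subst he
  refine ⟨_, _, .set x e s, ?_, hs.setReg hv, h (hs.setReg hv)⟩
  rw [Program.charge]
  nlinarith [e.cost_le hs]

theorem Run.put {a j v : ℕ} {i e : Expr} (hs : s.Bounded M) (hi : i.eval s = j)
    (he : e.eval s = v) (hv : v ≤ M)
    (h : (s.setArr a j v).Bounded M → Q (s.setArr a j v)) :
    Run M (.put a i e) s (Program.put a i e).charge Q := by
  subst he hi
  refine ⟨_, _, .put a i e s, ?_, hs.setArr hv, h (hs.setArr hv)⟩
  rw [Program.charge]
  nlinarith [e.cost_le hs, i.cost_le hs]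

theorem Run.seq (h : Run M p s c₁ fun s' => s'.Bounded M → Run M q s' c₂ Q) :
    Run M (.seq p q) s (c₁ + c₂) Q := by
  obtain ⟨s₁, t₁, h₁, h₂, h₃, h₄⟩ := h
  obtain ⟨s₂, t₂, k₁, k₂, k₃, k₄⟩ := h₄ h₃
  exact ⟨s₂, _, .seq h₁ k₁, by rw [add_mul]; exact add_le_add h₂ k₂, k₃, k₄⟩

theorem Run.set_seq {x v : ℕ} {e : Expr} (hs : s.Bounded M) (he : e.eval s = v) (hv : v ≤ M)
    (h : (s.setReg x v).Bounded M → Run M q (s.setReg x v) c Q) :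
    Run M (.seq (.set x e) q) s ((Program.set x e).charge + c) Q :=
  .seq (.set hs he hv fun h' _ => h h')

theorem Run.put_seq {a j v : ℕ} {i e : Expr} (hs : s.Bounded M) (hi : i.eval s = j)
    (he : e.eval s = v) (hv : v ≤ M)
    (h : (s.setArr a j v).Bounded M → Run M q (s.setArr a j v) c Q) :
    Run M (.seq (.put a i e) q) s ((Program.put a i e).charge + c) Q :=
  .seq (.put hs hi he hv fun h' _ => h h')

/-- Both branches are charged, so that the charge is a number read off the program text and
independent of the state. -/
theorem Run.branch {b : Expr} (hs : s.Bounded M) (hp : b.eval s ≠ 0 → Run M p s c₁ Q)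
    (hq : b.eval s = 0 → Run M q s c₂ Q) :
    Run M (.branch b p q) s (b.charge + 1 + (c₁ + c₂)) Q := by
  have hb := b.cost_le hs
  by_cases h : b.eval s = 0
  · obtain ⟨s', t, h₁, h₂, h₃, h₄⟩ := hq h
    exact ⟨s', _, .branch_false h h₁, by nlinarith, h₃, h₄⟩
  · obtain ⟨s', t, h₁, h₂, h₃, h₄⟩ := hp h
    exact ⟨s', _, .branch_true h h₁, by nlinarith, h₃, h₄⟩

/-- A loop with the invariant `I i` after `i` of `k` rounds. -/
theorem Run.loop {b : Expr} (I : ℕ → State → Prop) (k : ℕ) (hs : s.Bounded M) (h₀ : I 0 s)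
    (hstep : ∀ i < k, ∀ s, s.Bounded M → I i s → b.eval s ≠ 0 ∧ Run M p s c (I (i + 1)))
    (hend : ∀ s, s.Bounded M → I k s → b.eval s = 0) :
    Run M (.loop b p) s (k * (b.charge + 1 + c) + (b.charge + 1)) (I k) := by
  -- Induction on the number of remaining rounds, since an execution of a loop unfolds at its first
  -- round.
  suffices H : ∀ n ≤ k, ∀ s, s.Bounded M → I (k - n) s →
      Run M (.loop b p) s (n * (b.charge + 1 + c) + (b.charge + 1)) (I k) from
    H k le_rfl s hs (by simpa using h₀)
  intro n
  induction n with
  | zero =>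
    intro _ s hs h
    refine ⟨s, _, .loop_done (hend s hs h), ?_, hs, h⟩
    nlinarith [b.cost_le hs]
  | succ n ih =>
    intro hn s hs h
    obtain ⟨hb, s₁, t₁, h₁, h₂, h₃, h₄⟩ := hstep _ (by omega) s hs h
    rw [show k - (n + 1) + 1 = k - n by omega] at h₄
    obtain ⟨s₂, t₂, k₁, k₂, k₃, k₄⟩ := ih (by omega) s₁ h₃ h₄
    refine ⟨s₂, _, .loop_step hb h₁ k₁, ?_, k₃, k₄⟩
    have := b.cost_le hs
    nlinarith

end RAM

/-! ## Satisfiability as a property of quadruples of vectors -/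

namespace CNFFormula

variable {n : ℕ} (φ : CNFFormula n)

/-- The number of variables in each of four blocks: variable `x` is number `x / 4` of block
`x % 4`. -/
def blockSize (n : ℕ) : ℕ := (n + 3) / 4

/-- The number of partial assignments to one block, for all blocks together. -/
def numVec (n : ℕ) : ℕ := 4 * 2 ^ blockSize n

/-- The number of coordinates: one for each clause, and one for each block. -/
def dim : ℕ := φ.length + 4

/-- The partial assignment `v / 4` to block `v % 4` satisfies the literal `l`. -/
def satLit (v : ℕ) (l : Fin n × Bool) : Bool :=
  v % 4 = (l.1 : ℕ) % 4 ∧ v / 4 / 2 ^ ((l.1 : ℕ) / 4) % 2 = if l.2 then 1 else 0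

/-- The partial assignment `v` satisfies clause `j`; the last four coordinates tell its block. -/
def sat (v j : ℕ) : Bool :=
  if h : j < φ.length then φ[j].any (satLit v) else j = φ.length + v % 4

/-- The vector of the clauses that a partial assignment leaves unsatisfied. -/
def vec (v : Fin (numVec n)) (j : Fin φ.dim) : Bool := !φ.sat v j

theorem sat_add (v k : ℕ) : φ.sat v (φ.length + k) = decide (k = v % 4) := by
  simp [sat]

/-- Three vectors belong to at most three of the four blocks; the coordinate of a missed block is
one for all of them. -/
theorem exists_vec_triple (a b c : Fin (numVec n)) :
    ∃ j, φ.vec a j ∧ φ.vec b j ∧ φ.vec c j := by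
  have : ∃ k < 4, k ≠ (a : ℕ) % 4 ∧ k ≠ (b : ℕ) % 4 ∧ k ≠ (c : ℕ) % 4 := by
    by_contra! h
    have h₀ := h 0
    have h₁ := h 1
    have h₂ := h 2
    have h₃ := h 3
    omega
  obtain ⟨k, hk, h⟩ := this
  refine ⟨⟨φ.length + k, by simp only [dim]; omega⟩, ?_⟩
  simp [vec, sat_add, h]

theorem exists_bits (f : ℕ → Bool) (k : ℕ) :
    ∃ v < 2 ^ k, ∀ i < k, v / 2 ^ i % 2 = if f i then 1 else 0 := by
  induction k generalizing f with
  | zero => exact ⟨0, by simp⟩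
  | succ k ih =>
    obtain ⟨v, hv, h⟩ := ih fun i => f (i + 1)
    refine ⟨2 * v + (if f 0 then 1 else 0), ?_, ?_⟩
    · rw [pow_succ]; split_ifs <;> omega
    · rintro (_ | i) hi
      · split_ifs <;> simp
      · rw [pow_succ', ← Nat.div_div_eq_div_mul, ← h i (by omega)]
        congr 2
        split_ifs <;> omega

/-- By contraposition: the block coordinates force four non-meeting vectors to represent all four
blocks, one each, so they glue to one assignment; the clause coordinates say that it satisfies every
clause. -/
theorem allMeet_vec (h : ¬ φ.Satisfiable) : QuadGraph.AllMeet φ.vec := by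
  intro a b c d
  by_contra! hno
  apply h
  -- Uniqueness in each block matters: the vector that satisfies a literal must be the one from
  -- which the glued assignment takes that variable.
  have block : ∀ k < 4, ∃ v : ℕ, v % 4 = k ∧ ∀ w, (w = a ∨ w = b ∨ w = c ∨ w = d) →
      (w : ℕ) % 4 = k → (w : ℕ) = v := by
    have hk : ∀ k < 4, k = (a : ℕ) % 4 ∨ k = (b : ℕ) % 4 ∨ k = (c : ℕ) % 4 ∨ k = (d : ℕ) % 4 := by
      intro k hk
      have := hno ⟨φ.length + k, by simp only [dim]; omega⟩
      simp only [vec, sat_add, Bool.not_eq_true', decide_eq_false_iff_not] at this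
      by_contra! hne
      exact this hne.1 hne.2.1 hne.2.2.1 (by simpa using hne.2.2.2)
    have h₀ := hk 0
    have h₁ := hk 1
    have h₂ := hk 2
    have h₃ := hk 3
    intro k hk4
    obtain ⟨v, hv, hvk⟩ : ∃ v, (v = a ∨ v = b ∨ v = c ∨ v = d) ∧ (v : ℕ) % 4 = k := by
      rcases hk k hk4 with h | h | h | h
      exacts [⟨a, by simp, h.symm⟩, ⟨b, by simp, h.symm⟩, ⟨c, by simp, h.symm⟩,
        ⟨d, by simp, h.symm⟩]
    refine ⟨v, hvk, fun w hw hwk => ?_⟩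
    rcases hv with rfl | rfl | rfl | rfl <;> rcases hw with rfl | rfl | rfl | rfl <;>
      first | rfl | omega
  choose! g hg hgw using block
  refine ⟨fun x => g ((x : ℕ) % 4) / 4 / 2 ^ ((x : ℕ) / 4) % 2 = 1, fun C hC => ?_⟩
  obtain ⟨j, hj, rfl⟩ := List.getElem_of_mem hC
  have key : ∀ w, (w = a ∨ w = b ∨ w = c ∨ w = d) → φ.sat w j →
      ∃ l ∈ φ[j], decide (g ((l.1 : ℕ) % 4) / 4 / 2 ^ ((l.1 : ℕ) / 4) % 2 = 1) = l.2 := by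
    intro w hw hs
    simp only [sat, hj, dif_pos, List.any_eq_true, satLit, decide_eq_true_eq] at hs
    obtain ⟨l, hl, h₁, h₂⟩ := hs
    refine ⟨l, hl, ?_⟩
    rw [← hgw _ (Nat.mod_lt _ (by norm_num)) w hw h₁, h₂]
    cases l.2 <;> simp
  have := hno ⟨j, by simp only [dim]; omega⟩
  simp only [vec, Bool.not_eq_true'] at this
  by_cases ha : φ.sat a j
  · exact key a (by simp) ha
  by_cases hb : φ.sat b j
  · exact key b (by simp) hb
  by_cases hc : φ.sat c j
  · exact key c (by simp) hc
  simp only [Bool.not_eq_true] at ha hb hc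
  exact key d (by simp) (by simpa using this ha hb hc)

theorem exists_orthogonal (h : φ.Satisfiable) :
    ∃ a b c d, ∀ j, ¬ (φ.vec a j ∧ φ.vec b j ∧ φ.vec c j ∧ φ.vec d j) := by
  obtain ⟨f, hf⟩ := h
  have hv : ∀ k < 4, ∃ v : Fin (numVec n), (v : ℕ) % 4 = k ∧
      ∀ x : Fin n, (x : ℕ) % 4 = k →
        (v : ℕ) / 4 / 2 ^ ((x : ℕ) / 4) % 2 = if f x then 1 else 0 := by
    intro k hk
    obtain ⟨v, hv, h⟩ := exists_bits
      -- The last bits of a block may belong to no variable; they are set to `false`.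
      (fun i => if hi : 4 * i + k < n then f ⟨4 * i + k, hi⟩ else false) (blockSize n)
    refine ⟨⟨4 * v + k, by simp only [numVec]; omega⟩, by simp; omega, fun x hx => ?_⟩
    have hx' : 4 * ((x : ℕ) / 4) + k = x := by omega
    have e := h ((x : ℕ) / 4) (by have := x.2; simp only [blockSize]; omega)
    simp only [hx', x.2, dif_pos] at e
    rw [← e]
    congr 2
    simp only
    omega
  choose v hv hvx using hv
  refine ⟨v 0 (by norm_num), v 1 (by norm_num), v 2 (by norm_num), v 3 (by norm_num), ?_⟩
  rintro ⟨j, hj⟩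
  by_cases hj' : j < φ.length
  · obtain ⟨l, hl, hfl⟩ := hf φ[j] (List.getElem_mem hj')
    have key : ∀ k (hk : k < 4), (l.1 : ℕ) % 4 = k → φ.sat (v k hk) j := by
      intro k hk h
      simp only [sat, hj', dif_pos, List.any_eq_true, satLit, decide_eq_true_eq]
      exact ⟨l, hl, (hv k hk).trans h.symm, by rw [hvx k hk _ h, hfl]⟩
    simp only [vec, Bool.not_eq_true']
    rintro ⟨h₀, h₁, h₂, h₃⟩
    have : (l.1 : ℕ) % 4 < 4 := Nat.mod_lt _ (by norm_num)
    interval_cases hk : (l.1 : ℕ) % 4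
    · simp [key 0 (by norm_num) rfl] at h₀
    · simp [key 1 (by norm_num) rfl] at h₁
    · simp [key 2 (by norm_num) rfl] at h₂
    · simp [key 3 (by norm_num) rfl] at h₃
  · obtain ⟨k, rfl⟩ : ∃ k, j = φ.length + k := ⟨j - φ.length, by omega⟩
    have hk : k < 4 := by simp only [dim] at hj; omega
    simp only [vec, sat_add, hv]
    interval_cases k <;> simp

end CNFFormula

/-! ## The quadruple graph on an initial segment of the natural numbers -/

namespace QuadGraph

open Vertex

/-- The number of vertices, for `N` vectors with `d` coordinates. -/
def order (N d : ℕ) : ℕ := N * N * N + (N * N * d ^ 5 + N * N * d ^ 5)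

/-- The vertices as a sum type. -/
def vertexEquiv (A J : Type) :
    Vertex A J ≃ ((A × A) × A) ⊕ (((A × A) × (Fin 5 → J)) ⊕ ((A × A) × (Fin 5 → J))) where
  toFun
    | triple a b c => .inl ((a, b), c)
    | outer a b x => .inr (.inl ((a, b), x))
    | Vertex.inner a b x => .inr (.inr ((a, b), x))
  invFun
    | .inl ((a, b), c) => triple a b c
    | .inr (.inl ((a, b), x)) => outer a b x
    | .inr (.inr ((a, b), x)) => inner a b x
  left_inv := by rintro (_ | _ | _) <;> rfl
  right_inv := by rintro (⟨⟨_, _⟩, _⟩ | ⟨⟨_, _⟩, _⟩ | ⟨⟨_, _⟩, _⟩) <;> rfl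

variable {N d : ℕ}

/-- Numbers of pairs of vectors with coordinates. -/
def pairCode : (Fin N × Fin N) × (Fin 5 → Fin d) ≃ Fin (N * N * d ^ 5) :=
  (finProdFinEquiv.prodCongr finFunctionFinEquiv).trans finProdFinEquiv

/-- The numbering of the vertices. -/
def code : Vertex (Fin N) (Fin d) ≃ Fin (order N d) :=
  (vertexEquiv _ _).trans <|
    (((finProdFinEquiv.prodCongr (.refl _)).trans finProdFinEquiv).sumCongr
      ((pairCode.sumCongr pairCode).trans finSumFinEquiv)).trans finSumFinEquiv

/-- The numbering is composed of standard equivalences whose values unfold to these mixed radix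
formulas, which are the ones the program evaluates. -/
theorem code_triple (a b c : Fin N) :
    (code (d := d) (triple a b c) : ℕ) = c + N * (b + N * a) := rfl

theorem code_outer (a b : Fin N) (x : Fin 5 → Fin d) :
    (code (outer a b x) : ℕ) =
      N * N * N + (finFunctionFinEquiv x + d ^ 5 * (b + N * a)) := rfl

theorem code_inner (a b : Fin N) (x : Fin 5 → Fin d) :
    (code (inner a b x) : ℕ) =
      N * N * N + (N * N * d ^ 5 + (finFunctionFinEquiv x + d ^ 5 * (b + N * a))) := rfl

/-- Walks map to walks of the same length. Applied to an isomorphism and its inverse, this transfers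
the diameter to the numbered graph. -/
theorem ediam_le_of_hom {V W : Type} {G : SimpleGraph V} {H : SimpleGraph W} (f : G →g H)
    (hf : Function.Surjective f) : H.ediam ≤ G.ediam := by
  refine SimpleGraph.ediam_le_of_edist_le fun u v => ?_
  obtain ⟨u, rfl⟩ := hf u
  obtain ⟨v, rfl⟩ := hf v
  refine le_trans ?_ (SimpleGraph.edist_le_ediam (u := u) (v := v))
  by_cases h : G.edist u v = ⊤
  · rw [h]; exact le_top
  · obtain ⟨w, hw⟩ := SimpleGraph.exists_walk_of_edist_ne_top h
    rw [← hw, ← SimpleGraph.Walk.length_map f w]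
    exact SimpleGraph.edist_le _

/-- The quadruple graph on the numbers of the vertices. -/
def finGraph (r : Fin N → Fin d → Bool) : SimpleGraph (Fin (order N d)) :=
  (graph r).comap code.symm

variable (r : Fin N → Fin d → Bool)

/-- The numbering is an isomorphism. -/
def finGraphIso : finGraph r ≃g graph r where
  toEquiv := code.symm
  map_rel_iff' := .rfl

theorem ediam_finGraph : (finGraph r).ediam = (graph r).ediam :=
  le_antisymm (ediam_le_of_hom (finGraphIso r).symm.toHom (finGraphIso r).symm.surjective)
    (ediam_le_of_hom (finGraphIso r).toHom (finGraphIso r).surjective)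

theorem connected_finGraph (h : (graph r).Connected) : (finGraph r).Connected :=
  (finGraphIso r).connected_iff.2 h

/-! ### Candidate edges with uniform parameters -/

/-- The edges that may exist between vertices named by these parameters, with the conditions for
their existence. -/
def candidates (a b c : Fin N) (x y : Fin 5 → Fin d) :
    List (Prop × Vertex (Fin N) (Fin d) × Vertex (Fin N) (Fin d)) :=
  [(Fits r a b c x, triple a b c, outer a b x),
    (True, outer a b x, outer a b y),
    (5 ≤ count r [a] x ∧ 3 ≤ count r [b] x ∧ 4 ≤ count r [c] x, outer a b x, inner a c x),
    (5 ≤ count r [a] x ∧ 3 ≤ count r [b] x ∧ 4 ≤ count r [c] x, outer a b x, inner c a x),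
    (True, inner a b x, inner a b y),
    (4 ≤ count r [a] x ∧ 4 ≤ count r [b] x ∧ 5 ≤ count r [c] x, inner a b x, inner c c x)]

/-- All six kinds of edges are indexed by the same parameters, so a single loop over N^3 d^10 values
finds every edge. -/
theorem step_iff (u v : Vertex (Fin N) (Fin d)) :
    Step r u v ↔ ∃ a b c x y, ∃ p ∈ candidates r a b c x y, p.1 ∧ p.2 = (u, v) := by
  constructor
  · intro h
    cases h with
    -- Parameters that an edge does not use are filled with any values at hand.
    | pop a b c x h => exact ⟨a, b, c, x, x, (Fits r a b c x, _, _), by simp [candidates], h, rfl⟩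
    | shiftOuter a b x y =>
      exact ⟨a, b, a, x, y, (True, outer a b x, outer a b y), by simp [candidates], trivial, rfl⟩
    | enterLeft a b c x ha hb hc =>
      exact ⟨a, b, c, x, x, (_, outer a b x, inner a c x), .tail _ (.tail _ (.head _)),
        ⟨ha, hb, hc⟩, rfl⟩
    | enterRight a b c x ha hb hc =>
      exact ⟨a, b, c, x, x, (_, outer a b x, inner c a x), .tail _ (.tail _ (.tail _ (.head _))),
        ⟨ha, hb, hc⟩, rfl⟩
    | shiftInner a b x y =>
      exact ⟨a, b, a, x, y, (True, inner a b x, inner a b y), by simp [candidates], trivial, rfl⟩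
    | swap a b c x ha hb hc =>
      exact ⟨a, b, c, x, x, (_, inner a b x, inner c c x),
        .tail _ (.tail _ (.tail _ (.tail _ (.tail _ (.head _))))), ⟨ha, hb, hc⟩, rfl⟩
  · rintro ⟨a, b, c, x, y, p, hp, h, huv⟩
    simp only [candidates, List.mem_cons, List.not_mem_nil, or_false] at hp
    rcases hp with rfl | rfl | rfl | rfl | rfl | rfl <;> cases huv
    · exact .pop _ _ _ _ h
    · exact .shiftOuter _ _ _ _
    · exact .enterLeft _ _ _ _ h.1 h.2.1 h.2.2
    · exact .enterRight _ _ _ _ h.1 h.2.1 h.2.2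
    · exact .shiftInner _ _ _ _
    · exact .swap _ _ _ _ h.1 h.2.1 h.2.2

/-- The edge between two numbered vertices. -/
def codeEdge (p : Vertex (Fin N) (Fin d) × Vertex (Fin N) (Fin d)) : Sym2 (Fin (order N d)) :=
  s(code p.1, code p.2)

theorem adj_finGraph_iff (u v : Fin (order N d)) :
    (finGraph r).Adj u v ↔ ∃ a b c x y, ∃ p ∈ candidates r a b c x y,
      p.1 ∧ p.2.1 ≠ p.2.2 ∧ s(u, v) = codeEdge p.2 := by
  obtain ⟨u, rfl⟩ := code.surjective u
  obtain ⟨v, rfl⟩ := code.surjective v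
  simp only [finGraph, SimpleGraph.comap_adj, Equiv.symm_apply_apply, graph,
    SimpleGraph.fromRel_adj, step_iff]
  constructor
  · rintro ⟨hne, ⟨a, b, c, x, y, p, hp, h, huv⟩ | ⟨a, b, c, x, y, p, hp, h, huv⟩⟩
    · exact ⟨a, b, c, x, y, p, hp, h, by rwa [huv], by rw [huv]; rfl⟩
    · exact ⟨a, b, c, x, y, p, hp, h, by rw [huv]; exact hne.symm, by rw [huv]; exact Sym2.eq_swap⟩
  · rintro ⟨a, b, c, x, y, p, hp, h, hne, huv⟩
    simp only [codeEdge, Sym2.eq_iff, code.apply_eq_iff_eq] at huv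
    rcases huv with ⟨rfl, rfl⟩ | ⟨rfl, rfl⟩
    · exact ⟨hne, .inl ⟨a, b, c, x, y, p, hp, h, rfl⟩⟩
    · exact ⟨hne.symm, .inr ⟨a, b, c, x, y, p, hp, h, rfl⟩⟩

theorem isEdgeList_finGraph {E : List (Fin (order N d) × Fin (order N d))}
    (hE : (E.map fun e => s(e.1, e.2)).Nodup)
    (h : ∀ e, e ∈ E.map (fun e => s(e.1, e.2)) ↔ ∃ a b c x y, ∃ p ∈ candidates r a b c x y,
      p.1 ∧ p.2.1 ≠ p.2.2 ∧ e = codeEdge p.2) : IsEdgeList E (finGraph r) :=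
  ⟨hE, fun u v => by rw [h, adj_finGraph_iff]⟩

/-- Cardinalities become sums of bits, the form in which the program computes them. -/
theorem count_singleton (a : Fin N) (x : Fin 5 → Fin d) :
    count r [a] x = ∑ i, (r a (x i)).toNat := by
  rw [count, Finset.card_filter]
  exact Finset.sum_congr rfl fun i _ => by cases h : r a (x i) <;> simp [h]

theorem count_pair (a b : Fin N) (x : Fin 5 → Fin d) :
    count r [a, b] x = ∑ i, (r a (x i)).toNat * (r b (x i)).toNat := by
  rw [count, Finset.card_filter]
  exact Finset.sum_congr rfl fun i _ => by
    cases h : r a (x i) <;> cases h' : r b (x i) <;> simp [h, h']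

end QuadGraph

/-! ### Appending an edge to an encoded graph -/

theorem length_flatMap_pair {α β : Type*} (f g : α → β) (l : List α) :
    (l.flatMap fun e => [f e, g e]).length = 2 * l.length := by
  induction l with
  | nil => rfl
  | cons a l ih => simp only [List.flatMap_cons, List.length_append, ih, List.length_cons,
      List.length_nil]; ring

/-- Appending an edge amounts to three memory writes: two new cells at the end and the edge count in
cell 1. Cells past the end read as `0`, as in a start state. -/
theorem getD_encodeGraph_append {n : ℕ} (E : List (Fin n × Fin n)) (u v : Fin n) :
    (fun i => (encodeGraph (E ++ [(u, v)])).getD i 0) =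
      Function.update (Function.update (Function.update (fun i => (encodeGraph E).getD i 0)
        (2 + 2 * E.length) (u : ℕ)) (3 + 2 * E.length) (v : ℕ)) 1 (E.length + 1) := by
  have hl := length_flatMap_pair (fun e : Fin n × Fin n => (e.1 : ℕ)) (fun e => (e.2 : ℕ)) E
  funext i
  simp only [encodeGraph, Function.update_apply, List.flatMap_append, List.length_append]
  rcases i with _ | _ | i
  · rw [if_neg (by omega), if_neg (by omega), if_neg (by omega)]
    simp
  · simp
  · simp only [List.getD_cons_succ, List.length_cons, List.flatMap_cons,
      List.flatMap_nil]
    rw [if_neg (by omega)]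
    rcases lt_trichotomy i (2 * E.length) with h | h | h
    · rw [if_neg (by omega), if_neg (by omega), List.getD_append _ _ _ _ (by omega)]
    · rw [if_neg (by omega), if_pos (by omega), List.getD_append_right _ _ _ _ (by omega)]
      simp [h, hl]
    · rw [List.getD_append_right _ _ _ _ (by omega), hl]
      obtain h | h : i = 2 * E.length + 1 ∨ 2 * E.length + 2 ≤ i := by omega
      · rw [if_pos (by omega)]
        simp [h]
      · rw [if_neg (by omega), if_neg (by omega), List.getD_eq_default _ _ (by simp; omega),
          List.getD_eq_default _ _ (by omega)]

/-! ## The program that writes down the quadruple graph -/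

namespace QuadGraph

open RAM RAM.Expr RAM.Program Vertex

variable {N d M : ℕ}

/-- The edges of a list as unordered pairs. -/
def edgesOf {n : ℕ} (E : List (Fin n × Fin n)) : List (Sym2 (Fin n)) :=
  E.map fun e => s(e.1, e.2)

/-- Arrays: `2` holds the vectors (complemented), `3` marks the edges found so far, and `32` is
their list. Registers: `1` to `5` hold the numbers of vectors, of coordinates, of quintuples of
coordinates, of vertices and of rounds, `6` counts the rounds and `8` to `12` hold the
parameters of the candidate edges. -/
structure Frame (i : ℕ) (a b c : Fin N) (x y : Fin 5 → Fin d) (s : State) : Prop where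
  reg1 : s.reg 1 = N
  reg2 : s.reg 2 = d
  reg3 : s.reg 3 = d ^ 5
  reg4 : s.reg 4 = order N d
  reg5 : s.reg 5 = N * N * N * (d ^ 5 * d ^ 5)
  reg6 : s.reg 6 = i
  reg8 : s.reg 8 = a
  reg9 : s.reg 9 = b
  reg10 : s.reg 10 = c
  reg11 : s.reg 11 = finFunctionFinEquiv x
  reg12 : s.reg 12 = finFunctionFinEquiv y

/-- The edges `E` have been written down. -/
structure Building (r : Fin N → Fin d → Bool) (E : List (Fin (order N d) × Fin (order N d)))
    (s : State) : Prop where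
  reg7 : s.reg 7 = E.length
  table (v : Fin N) (j : Fin d) : s.arr 2 (v * d + j) = (!r v j).toNat
  mark (u v : Fin (order N d)) :
    s.arr 3 (u * order N d + v) = if s(u, v) ∈ edgesOf E then 1 else 0
  out : s.arr 32 = fun i => (encodeGraph E).getD i 0
  clean_reg : ∀ x, 32 ≤ x → s.reg x = 0
  clean_arr : ∀ a, 32 < a → s.arr a = fun _ => 0
  nodup : (edgesOf E).Nodup

theorem Frame.congr {i : ℕ} {a b c : Fin N} {x y : Fin 5 → Fin d} {s s' : State}
    (h : Frame i a b c x y s) (hs : ∀ x, x ≠ 7 → s'.reg x = s.reg x) :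
    Frame i a b c x y s' := by
  constructor <;> rw [hs _ (by norm_num)]
  exacts [h.reg1, h.reg2, h.reg3, h.reg4, h.reg5, h.reg6, h.reg8, h.reg9, h.reg10, h.reg11,
    h.reg12]

/-- The address in array `3` for a pair of vertices. -/
def markAddr (u v : Expr) : Expr := add (mul u (reg 4)) v

/-- Write down the edge from `u` to `v` if the condition holds and the edge is new. -/
def emit (cond u v : Expr) : Program :=
  branch (mul cond (mul (add (sub u v) (sub v u)) (sub (const 1) (get 3 (markAddr u v)))))
    (seq (put 3 (markAddr u v) (const 1)) <|
      seq (put 3 (markAddr v u) (const 1)) <|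
      seq (put 32 (add (const 2) (mul (const 2) (reg 7))) u) <|
      seq (put 32 (add (const 3) (mul (const 2) (reg 7))) v) <|
      seq (put 32 (const 1) (add (reg 7) (const 1))) <|
      set 7 (add (reg 7) (const 1)))
    skip

theorem pair_eq_iff {n : ℕ} {u v u' v' : Fin n} :
    (u : ℕ) * n + v = u' * n + v' ↔ u = u' ∧ v = v' := by
  constructor
  · intro h
    have hn : 0 < n := u.pos
    have h₁ : (u : ℕ) = u' := by
      have := congrArg (· / n) h
      simpa [Nat.mul_comm _ n, Nat.mul_add_div hn, Nat.div_eq_of_lt] using this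
    rw [h₁] at h
    exact ⟨Fin.ext h₁, Fin.ext (by omega)⟩
  · rintro ⟨rfl, rfl⟩; rfl

/-- The branch tests a product, nonzero exactly if the condition holds, the ends differ (the two
truncated differences do not both vanish), and the pair is unmarked. Marks are set in both orders,
so an edge found again in either orientation is not repeated. -/
theorem emit_run {r : Fin N → Fin d → Bool} {E : List (Fin (order N d) × Fin (order N d))}
    {s : State} {i : ℕ} {a b c : Fin N} {x y : Fin 5 → Fin d} (hs : s.Bounded M)
    (hV : order N d ≤ M) (hE : E.length + 1 ≤ M) (hF : Frame i a b c x y s)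
    (hB : Building r E s) {u v : Fin (order N d)} {cond eu ev : Expr} {P : Prop}
    (hu : ∀ s, Frame i a b c x y s → eu.eval s = u) (hv : ∀ s, Frame i a b c x y s → ev.eval s = v)
    (hc : cond.eval s ≠ 0 ↔ P) :
    Run M (emit cond eu ev) s (emit cond eu ev).charge fun s' => ∃ E',
      E'.length ≤ E.length + 1 ∧ Building r E' s' ∧ Frame i a b c x y s' ∧
        ∀ e, e ∈ edgesOf E' ↔ e ∈ edgesOf E ∨ (P ∧ u ≠ v ∧ e = s(u, v)) := by
  have hM := hs.two_le
  have haddr : ∀ s', s'.reg = s.reg → (markAddr eu ev).eval s' = u * order N d + v ∧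
      (markAddr ev eu).eval s' = v * order N d + u := by
    intro s' h
    have hF' : Frame i a b c x y s' := hF.congr fun _ _ => by rw [h]
    simp [markAddr, Expr.eval, hu s' hF', hv s' hF', hF'.reg4]
  refine Run.branch hs (fun h => ?_) fun h => .skip hs ⟨E, by omega, hB, hF, fun e => ?_⟩
  · simp only [Expr.eval, mul_ne_zero_iff, hc, hu s hF, hv s hF, (haddr s rfl).1,
      hB.mark] at h
    obtain ⟨hP, hne, hmem⟩ := h
    have huv : u ≠ v := by rintro rfl; omega
    have hnew : s(u, v) ∉ edgesOf E := by
      intro hm; simp [hm] at hmem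
    have hF₁ : ∀ s', s'.reg = s.reg → Frame i a b c x y s' := fun s' h =>
      hF.congr fun _ _ => by rw [h]
    refine .put_seq hs (haddr _ rfl).1 (v := 1) rfl (by omega) fun hs => ?_
    refine .put_seq hs (haddr (s.setArr _ _ _) rfl).2 (v := 1) rfl (by omega) fun hs => ?_
    refine .put_seq (j := 2 + 2 * E.length) hs (by simp [Expr.eval, hB.reg7]) (hu (State.setArr _ _ _ _) (hF₁ _ rfl))
      (by omega) fun hs => ?_
    refine .put_seq (j := 3 + 2 * E.length) hs (by simp [Expr.eval, hB.reg7]) (hv (State.setArr _ _ _ _) (hF₁ _ rfl))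
      (by omega) fun hs => ?_
    refine .put_seq hs rfl (v := E.length + 1) (by simp [Expr.eval, hB.reg7]) hE fun hs => ?_
    refine .set hs (v := E.length + 1) (by simp [Expr.eval, hB.reg7]) hE fun hs => ?_
    have hm : ∀ e, e ∈ edgesOf (E ++ [(u, v)]) ↔ e ∈ edgesOf E ∨ e = s(u, v) := by
      intro e; simp [edgesOf]
    refine ⟨E ++ [(u, v)], by simp, ?_, hF.congr fun x hx => by simp [hx], fun e => ?_⟩
    · simp only [Expr.eval]
      constructor
      · simp
      · intro v j; simpa using hB.table v j
      · intro u' v'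
        simp only [hm, State.setReg_arr, State.setArr_arr, Nat.reduceEqDiff,
          if_true, if_false, Function.update_apply, pair_eq_iff, hB.mark, Sym2.eq_iff]
        by_cases h₁ : u' = v ∧ v' = u
        · simp [h₁]
        · by_cases h₂ : u' = u ∧ v' = v
          · simp [h₂]
          · simp [h₁, h₂]
      · have := getD_encodeGraph_append E u v
        simp only [State.setReg_arr, State.setArr_arr, if_true, this, hB.out]
        norm_num
      · intro x hx
        rw [State.setReg_reg, if_neg (by omega)]
        exact hB.clean_reg x hx
      · intro a ha
        have h₁ : a ≠ 32 := by omega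
        have h₂ : a ≠ 3 := by omega
        simp only [State.setReg_arr, State.setArr_arr, h₁, h₂, if_false]
        exact hB.clean_arr a ha
      · simp only [edgesOf, List.map_append, List.map_cons, List.map_nil]
        exact List.Nodup.append hB.nodup (by simp) (by simpa [edgesOf] using hnew)
    · rw [hm]; simp [hP, huv]
  · simp only [Expr.eval, mul_eq_zero, hu s hF, hv s hF, (haddr s rfl).1, hB.mark] at h
    constructor
    · exact .inl
    · rintro (h' | ⟨hP, huv, rfl⟩)
      · exact h'
      · have : (u : ℕ) ≠ v := fun h => huv (Fin.ext h)
        rcases h with h | h | h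
        · exact absurd h (hc.2 hP)
        · omega
        · by_contra hm; simp [hm] at h

end QuadGraph

/-! ### Expressions for the candidate edges, and the main loop -/

namespace QuadGraph

open RAM RAM.Expr RAM.Program Vertex

variable {N d M : ℕ}

/-- The power `d ^ k`. -/
def powE : ℕ → Expr
  | 0 => const 1
  | k + 1 => mul (powE k) (reg 2)

/-- Entry of the vector in register `v` at position `k` of the coordinates in register `11`. -/
def bitE (v k : ℕ) : Expr :=
  sub (const 1) (get 2 (add (mul (reg v) (reg 2)) (mod (div (reg 11) (powE k)) (reg 2))))

/-- The sum over all five positions. -/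
def sumE (f : ℕ → Expr) : Expr := add (add (add (add (f 0) (f 1)) (f 2)) (f 3)) (f 4)

/-- The count for one vector. -/
def countE (v : ℕ) : Expr := sumE (bitE v)

/-- The count for two vectors. -/
def countPairE (v w : ℕ) : Expr := sumE fun k => mul (bitE v k) (bitE w k)

/-- Number of the vertex `triple a b c`. -/
def tripleE (a b c : ℕ) : Expr :=
  add (reg c) (mul (reg 1) (add (reg b) (mul (reg 1) (reg a))))

/-- The number of pairs of vectors with coordinates that come before a given one. -/
def pairE (a b x : ℕ) : Expr :=
  add (reg x) (mul (reg 3) (add (reg b) (mul (reg 1) (reg a))))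

/-- The cube of the number of vectors. -/
def cubeE : Expr := mul (mul (reg 1) (reg 1)) (reg 1)

/-- Number of the vertex `outer a b x`. -/
def outerE (a b x : ℕ) : Expr := add cubeE (pairE a b x)

/-- Number of the vertex `inner a b x`. -/
def innerE (a b x : ℕ) : Expr :=
  add cubeE (add (mul (mul (reg 1) (reg 1)) (reg 3)) (pairE a b x))

/-- Not `0` if the counts for the vectors in registers `u`, `v`, `w` exceed `i`, `j`, `k`. -/
def countsE (u i v j w k : ℕ) : Expr :=
  mul (sub (countE u) (const i)) (mul (sub (countE v) (const j)) (sub (countE w) (const k)))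

/-- Conditions and end points of the candidate edges. -/
def candidatesE : List (Expr × Expr × Expr) :=
  [(mul (sub (countE 8) (const 4)) (mul (sub (countE 9) (const 2))
      (sub (countPairE 9 10) (const 1))), tripleE 8 9 10, outerE 8 9 11),
    (const 1, outerE 8 9 11, outerE 8 9 12),
    (countsE 8 4 9 2 10 3, outerE 8 9 11, innerE 8 10 11),
    (countsE 8 4 9 2 10 3, outerE 8 9 11, innerE 10 8 11),
    (const 1, innerE 8 9 11, innerE 8 9 12),
    (countsE 8 3 9 3 10 4, innerE 8 9 11, innerE 10 10 11)]

/-- Run `emit` for all expressions of a list. -/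
def emitAll : List (Expr × Expr × Expr) → Program
  | [] => skip
  | p :: l => seq (emit p.1 p.2.1 p.2.2) (emitAll l)

/-- Write down the candidate edges of one round. -/
def round : Program :=
  seq (set 8 (mod (reg 6) (reg 1))) <|
  seq (set 9 (mod (div (reg 6) (reg 1)) (reg 1))) <|
  seq (set 10 (mod (div (div (reg 6) (reg 1)) (reg 1)) (reg 1))) <|
  seq (set 11 (mod (div (div (div (reg 6) (reg 1)) (reg 1)) (reg 1)) (reg 3))) <|
  seq (set 12 (mod (div (div (div (div (reg 6) (reg 1)) (reg 1)) (reg 1)) (reg 3)) (reg 3))) <|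
  seq (emitAll candidatesE) <|
  set 6 (add (reg 6) (const 1))

/-- Write down the quadruple graph. -/
def buildLoop : Program := loop (sub (reg 5) (reg 6)) round

section

variable {r : Fin N → Fin d → Bool} {s : State} {i : ℕ} {a b c : Fin N} {x y : Fin 5 → Fin d}

theorem eval_powE (h : s.reg 2 = d) (k : ℕ) : (powE k).eval s = d ^ k := by
  induction k with
  | zero => simp [powE, Expr.eval]
  | succ k ih => simp [powE, Expr.eval, ih, h, pow_succ]

/-- The entries of a tuple are the base `d` digits of its number. The table holds complements, which
the outer subtraction undoes. -/
theorem eval_bitE (h₂ : s.reg 2 = d) (h₁₁ : s.reg 11 = finFunctionFinEquiv x)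
    (ht : ∀ (v : Fin N) (j : Fin d), s.arr 2 (v * d + j) = (!r v j).toNat) {u : ℕ} {v : Fin N}
    (hu : s.reg u = v) (k : Fin 5) : (bitE u k).eval s = (r v (x k)).toNat := by
  have hd : (finFunctionFinEquiv x : ℕ) / d ^ (k : ℕ) % d = x k :=
    congrArg Fin.val (congrFun (finFunctionFinEquiv.symm_apply_apply x) k)
  simp only [bitE, Expr.eval, eval_powE h₂, h₁₁, h₂, hu, hd, ht]
  cases r v (x k) <;> rfl

theorem eval_countE (h₂ : s.reg 2 = d) (h₁₁ : s.reg 11 = finFunctionFinEquiv x)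
    (ht : ∀ (v : Fin N) (j : Fin d), s.arr 2 (v * d + j) = (!r v j).toNat) {u : ℕ} {v : Fin N}
    (hu : s.reg u = v) : (countE u).eval s = count r [v] x := by
  have h := eval_bitE h₂ h₁₁ ht hu
  simp only [count_singleton, Fin.sum_univ_five, ← h]
  rfl

theorem eval_countPairE (h₂ : s.reg 2 = d) (h₁₁ : s.reg 11 = finFunctionFinEquiv x)
    (ht : ∀ (v : Fin N) (j : Fin d), s.arr 2 (v * d + j) = (!r v j).toNat) {u u' : ℕ}
    {v v' : Fin N} (hu : s.reg u = v) (hu' : s.reg u' = v') :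
    (countPairE u u').eval s = count r [v, v'] x := by
  have h := eval_bitE h₂ h₁₁ ht hu
  have h' := eval_bitE h₂ h₁₁ ht hu'
  simp only [count_pair, Fin.sum_univ_five, ← h, ← h']
  rfl

/-- The expressions compute a candidate edge and the condition for it. -/
def Computes (r : Fin N → Fin d → Bool) (i : ℕ) (a b c : Fin N) (x y : Fin 5 → Fin d)
    (e : Expr × Expr × Expr) (p : Prop × Vertex (Fin N) (Fin d) × Vertex (Fin N) (Fin d)) : Prop :=
  (∀ s, Frame i a b c x y s →
    (∀ (v : Fin N) (j : Fin d), s.arr 2 (v * d + j) = (!r v j).toNat) →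
      (e.1.eval s ≠ 0 ↔ p.1)) ∧
  (∀ s, Frame i a b c x y s → e.2.1.eval s = code p.2.1) ∧
  ∀ s, Frame i a b c x y s → e.2.2.eval s = code p.2.2

/-- A truncated difference is nonzero exactly for a strict inequality, so the constants in the
expressions are one below the thresholds. -/
theorem computes_candidates :
    List.Forall₂ (Computes r i a b c x y) candidatesE (candidates r a b c x y) := by
  have counts : ∀ s, Frame i a b c x y s →
      (∀ (v : Fin N) (j : Fin d), s.arr 2 (v * d + j) = (!r v j).toNat) →
      (countE 8).eval s = count r [a] x ∧ (countE 9).eval s = count r [b] x ∧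
      (countE 10).eval s = count r [c] x ∧ (countPairE 9 10).eval s = count r [b, c] x :=
    fun s hF ht => ⟨eval_countE hF.reg2 hF.reg11 ht hF.reg8, eval_countE hF.reg2 hF.reg11 ht hF.reg9,
      eval_countE hF.reg2 hF.reg11 ht hF.reg10,
      eval_countPairE hF.reg2 hF.reg11 ht hF.reg9 hF.reg10⟩
  have positive : ∀ s, Frame i a b c x y s →
      (∀ (v : Fin N) (j : Fin d), s.arr 2 (v * d + j) = (!r v j).toNat) →
      ((const 1).eval s ≠ 0 ↔ True) := fun s _ _ => by simp [Expr.eval]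
  simp only [candidatesE, candidates, List.forall₂_cons, List.forall₂_nil_left_iff, and_true]
  refine ⟨⟨fun s hF ht => ?_, fun s hF => ?_, fun s hF => ?_⟩,
    ⟨positive, fun s hF => ?_, fun s hF => ?_⟩,
    ⟨fun s hF ht => ?_, fun s hF => ?_, fun s hF => ?_⟩,
    ⟨fun s hF ht => ?_, fun s hF => ?_, fun s hF => ?_⟩,
    ⟨positive, fun s hF => ?_, fun s hF => ?_⟩,
    ⟨fun s hF ht => ?_, fun s hF => ?_, fun s hF => ?_⟩⟩
  any_goals
    simp only [tripleE, outerE, innerE, pairE, cubeE, Expr.eval, hF.reg1, hF.reg3, hF.reg8,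
      hF.reg9, hF.reg10, hF.reg11, hF.reg12, code_triple, code_outer, code_inner]
  all_goals
    obtain ⟨h₁, h₂, h₃, h₄⟩ := counts s hF ht
    simp only [countsE, Expr.eval, h₁, h₂, h₃, h₄, mul_ne_zero_iff, Nat.sub_ne_zero_iff_lt, Fits,
      Nat.lt_iff_add_one_le]

theorem emitAll_run {L : List (Expr × Expr × Expr)}
    {l : List (Prop × Vertex (Fin N) (Fin d) × Vertex (Fin N) (Fin d))}
    (hL : List.Forall₂ (Computes r i a b c x y) L l) (hV : order N d ≤ M) :
    ∀ {E : List (Fin (order N d) × Fin (order N d))} {s : State}, s.Bounded M →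
      E.length + l.length ≤ M → Frame i a b c x y s → Building r E s →
      Run M (emitAll L) s (emitAll L).charge fun s' => ∃ E',
        E'.length ≤ E.length + l.length ∧ Building r E' s' ∧ Frame i a b c x y s' ∧
          ∀ e, e ∈ edgesOf E' ↔ e ∈ edgesOf E ∨
            ∃ p ∈ l, p.1 ∧ p.2.1 ≠ p.2.2 ∧ e = codeEdge p.2 := by
  induction hL with
  | nil => exact fun hs hE hF hB => .skip hs ⟨_, le_rfl, hB, hF, fun e => by simp⟩
  | @cons e p L l h _ ih =>
    intro E s hs hE hF hB
    simp only [List.length_cons] at hE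
    refine Run.seq ((emit_run hs hV (by omega) hF hB h.2.1 h.2.2 (h.1 s hF hB.table)).mono le_rfl ?_)
    rintro s₁ hs₁ ⟨E₁, hE₁, hB₁, hF₁, hmem₁⟩ -
    refine (ih hs₁ (by omega) hF₁ hB₁).mono le_rfl ?_
    rintro s₂ - ⟨E₂, hE₂, hB₂, hF₂, hmem₂⟩
    refine ⟨E₂, by simp only [List.length_cons]; omega, hB₂, hF₂, fun e => ?_⟩
    rw [hmem₂, hmem₁]
    simp only [List.mem_cons, exists_eq_or_imp, or_assoc, codeEdge, ne_eq, code.apply_eq_iff_eq]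

end

/-! ### Enumeration of all parameters by a round counter -/

/-- The vectors and coordinates of round `i`. -/
def roundEdges (r : Fin N → Fin d → Bool) (hN : 0 < N) (hd : 0 < d) (i : ℕ) :
    List (Prop × Vertex (Fin N) (Fin d) × Vertex (Fin N) (Fin d)) :=
  candidates r ⟨i % N, Nat.mod_lt _ hN⟩ ⟨i / N % N, Nat.mod_lt _ hN⟩
    ⟨i / N / N % N, Nat.mod_lt _ hN⟩
    (finFunctionFinEquiv.symm ⟨i / N / N / N % d ^ 5, Nat.mod_lt _ (pow_pos hd 5)⟩)
    (finFunctionFinEquiv.symm ⟨i / N / N / N / d ^ 5 % d ^ 5, Nat.mod_lt _ (pow_pos hd 5)⟩)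

/-- The round counter is read in mixed radix N, N, N, d^5, d^5, and every string of digits is the
expansion of some number below the product. -/
theorem exists_round (r : Fin N → Fin d → Bool) (hN : 0 < N) (hd : 0 < d) (a b c : Fin N)
    (x y : Fin 5 → Fin d) :
    ∃ i < N * N * N * (d ^ 5 * d ^ 5), roundEdges r hN hd i = candidates r a b c x y := by
  have hD : 0 < d ^ 5 := pow_pos hd 5
  obtain ⟨X, rfl⟩ := finFunctionFinEquiv.symm.surjective x
  obtain ⟨Y, rfl⟩ := finFunctionFinEquiv.symm.surjective y
  have step : ∀ {n p q m : ℕ}, p < n → q < m → p + n * q < n * m := by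
    intro n p q m hp hq
    calc p + n * q < n * (q + 1) := by rw [mul_add]; omega
      _ ≤ n * m := Nat.mul_le_mul_left _ hq
  refine ⟨a + N * (b + N * (c + N * (X + d ^ 5 * Y))), ?_, ?_⟩
  · have := step a.2 (step b.2 (step c.2 (step X.2 Y.2)))
    calc _ < _ := this
      _ = _ := by ring
  · have dm : ∀ {n p q : ℕ}, p < n → (p + n * q) % n = p ∧ (p + n * q) / n = q := by
      intro n p q hp
      refine ⟨by rw [Nat.add_mul_mod_self_left, Nat.mod_eq_of_lt hp], ?_⟩
      rw [Nat.add_mul_div_left _ _ (by omega), Nat.div_eq_of_lt hp, zero_add]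
    simp only [roundEdges, dm a.2, dm b.2, dm c.2, dm X.2, Nat.mod_eq_of_lt Y.2]

/-- State after `i` rounds. -/
structure Rounds (r : Fin N → Fin d → Bool) (hN : 0 < N) (hd : 0 < d) (i : ℕ) (s : State) :
    Prop where
  reg1 : s.reg 1 = N
  reg2 : s.reg 2 = d
  reg3 : s.reg 3 = d ^ 5
  reg4 : s.reg 4 = order N d
  reg5 : s.reg 5 = N * N * N * (d ^ 5 * d ^ 5)
  reg6 : s.reg 6 = i
  building : ∃ E, E.length ≤ 6 * i ∧ Building r E s ∧ ∀ e, e ∈ edgesOf E ↔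
    ∃ j < i, ∃ p ∈ roundEdges r hN hd j, p.1 ∧ p.2.1 ≠ p.2.2 ∧ e = codeEdge p.2

theorem Building.setReg {r : Fin N → Fin d → Bool} {E : List (Fin (order N d) × Fin (order N d))}
    {s : State} (h : Building r E s) {x v : ℕ} (hx : x ≠ 7) (hx' : x < 32) :
    Building r E (s.setReg x v) where
  reg7 := by simpa [hx.symm] using h.reg7
  table := h.table
  mark := h.mark
  out := h.out
  clean_reg y hy := by rw [State.setReg_reg, if_neg (by omega)]; exact h.clean_reg y hy
  clean_arr := h.clean_arr
  nodup := h.nodup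

theorem round_run {r : Fin N → Fin d → Bool} {hN : 0 < N} {hd : 0 < d} {i : ℕ} {s : State}
    (hs : s.Bounded M) (hM : 6 * (N * N * N * (d ^ 5 * d ^ 5)) ≤ M)
    (hV : order N d ≤ M) (hi : i < N * N * N * (d ^ 5 * d ^ 5)) (h : Rounds r hN hd i s) :
    Run M round s round.charge (Rounds r hN hd (i + 1)) := by
  obtain ⟨E, hE, hB, hmem⟩ := h.building
  have le₁ : ∀ p q, i / p % q ≤ M := fun p q =>
    (Nat.mod_le _ _).trans ((Nat.div_le_self _ _).trans (by omega))
  have le₂ : ∀ p q k, i / p / q % k ≤ M := fun p q k =>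
    (Nat.mod_le _ _).trans ((Nat.div_le_self _ _).trans ((Nat.div_le_self _ _).trans (by omega)))
  have le₃ : ∀ p q k l, i / p / q / k % l ≤ M := fun p q k l => by
    rw [Nat.div_div_eq_div_mul i p q]; exact le₂ _ _ _
  have le₄ : ∀ p q k l m, i / p / q / k / l % m ≤ M := fun p q k l m => by
    rw [Nat.div_div_eq_div_mul i p q]; exact le₃ _ _ _ _
  refine .set_seq (v := i % N) hs (by simp [Expr.eval, h.reg6, h.reg1])
    ((Nat.mod_le _ _).trans (by omega)) fun hs => ?_
  refine .set_seq (v := i / N % N) hs (by simp [Expr.eval, h.reg6, h.reg1]) (le₁ _ _) fun hs => ?_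
  refine .set_seq (v := i / N / N % N) hs (by simp [Expr.eval, h.reg6, h.reg1]) (le₂ _ _ _)
    fun hs => ?_
  refine .set_seq (v := i / N / N / N % d ^ 5) hs (by simp [Expr.eval, h.reg6, h.reg1, h.reg3])
    (le₃ _ _ _ _) fun hs => ?_
  refine .set_seq (v := i / N / N / N / d ^ 5 % d ^ 5) hs
    (by simp [Expr.eval, h.reg6, h.reg1, h.reg3]) (le₄ _ _ _ _ _) fun hs => ?_
  refine Run.seq ((emitAll_run (l := roundEdges r hN hd i) (i := i)
    (E := E) (computes_candidates (r := r)) hV hs ?_ ?_ ?_).mono le_rfl ?_)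
  · simp only [roundEdges, candidates, List.length_cons, List.length_nil]; omega
  · constructor <;> simp [h.reg1, h.reg2, h.reg3, h.reg4, h.reg5, h.reg6]
  · exact ((((hB.setReg (by norm_num) (by norm_num)).setReg (by norm_num) (by norm_num)).setReg
      (by norm_num) (by norm_num)).setReg (by norm_num) (by norm_num)).setReg
      (by norm_num) (by norm_num)
  · rintro s₁ - ⟨E₁, hE₁, hB₁, hF₁, hmem₁⟩ hs₁
    refine .set (v := i + 1) hs₁ (by simp [Expr.eval, hF₁.reg6]) (by omega) fun _ => ?_
    refine ⟨by simp [hF₁.reg1], by simp [hF₁.reg2], by simp [hF₁.reg3], by simp [hF₁.reg4],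
      by simp [hF₁.reg5], by simp, E₁, ?_, hB₁.setReg (by norm_num) (by norm_num), fun e => ?_⟩
    · simp only [roundEdges, candidates, List.length_cons, List.length_nil] at hE₁; omega
    · simp only [hmem₁, hmem, Nat.lt_succ_iff_lt_or_eq, or_and_right, exists_or, exists_eq_left]

theorem buildLoop_run {r : Fin N → Fin d → Bool} {hN : 0 < N} {hd : 0 < d} {s : State}
    (hs : s.Bounded M) (hM : 6 * (N * N * N * (d ^ 5 * d ^ 5)) ≤ M)
    (hV : order N d ≤ M) (h : Rounds r hN hd 0 s) :
    Run M buildLoop s (N * N * N * (d ^ 5 * d ^ 5) *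
      ((sub (reg 5) (reg 6)).charge + 1 + round.charge) + ((sub (reg 5) (reg 6)).charge + 1))
      (Rounds r hN hd (N * N * N * (d ^ 5 * d ^ 5))) :=
  Run.loop (Rounds r hN hd) _ hs h
    (fun i hi s hs h => ⟨by simp only [Expr.eval, h.reg5, h.reg6]; omega,
      round_run hs hM hV hi h⟩)
    fun s _ h => by simp [Expr.eval, h.reg5, h.reg6]

/-- The edges written down in all rounds are those of the quadruple graph. -/
theorem Rounds.isEdgeList {r : Fin N → Fin d → Bool} {hN : 0 < N} {hd : 0 < d} {s : State}
    (h : Rounds r hN hd (N * N * N * (d ^ 5 * d ^ 5)) s) :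
    ∃ E, IsEdgeList E (finGraph r) ∧ E.length ≤ 6 * (N * N * N * (d ^ 5 * d ^ 5)) ∧
      s.upper 32 = start (encodeGraph E) := by
  obtain ⟨E, hE, hB, hmem⟩ := h.building
  refine ⟨E, isEdgeList_finGraph r hB.nodup fun e => (hmem e).trans ⟨?_, ?_⟩, hE, ?_⟩
  · rintro ⟨j, -, p, hp, hh⟩
    exact ⟨_, _, _, _, _, p, hp, hh⟩
  · rintro ⟨a, b, c, x, y, p, hp, hh⟩
    obtain ⟨i, hi, hr⟩ := exists_round r hN hd a b c x y
    exact ⟨i, hi, p, hr ▸ hp, hh⟩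
  · simp only [State.upper, start, State.mk.injEq]
    refine ⟨funext fun x => hB.clean_reg _ (by omega), funext fun a => ?_⟩
    rcases a with _ | a
    · simpa using hB.out
    · rw [hB.clean_arr _ (by omega)]; simp

end QuadGraph

/-! ## The program that reads a formula and tabulates its vectors -/

namespace CNFFormula

variable {n : ℕ} (φ : CNFFormula n)

/-- A literal as a number. -/
def litCode (l : Fin n × Bool) : ℕ := 2 * (l.1 : ℕ) + (if l.2 then 1 else 0)

/-- Where clause `j` stands in the input. -/
def clausePos (j : ℕ) : ℕ :=
  2 + ((φ.take j).flatMap fun C => C.length :: C.map litCode).length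

theorem clausePos_zero : φ.clausePos 0 = 2 := rfl

theorem clausePos_succ {j : ℕ} (hj : j < φ.length) :
    φ.clausePos (j + 1) = φ.clausePos j + 1 + φ[j].length := by
  simp only [clausePos, List.take_add_one, List.getElem?_eq_getElem hj, Option.toList_some,
    List.flatMap_append, List.flatMap_cons, List.flatMap_nil, List.length_append, List.length_cons,
    List.length_map, List.append_nil]
  omega

/-- Clauses have variable lengths, so random access to the input goes through this splitting around
one clause. -/
theorem encode_split {j : ℕ} (hj : j < φ.length) :
    ∃ l l', φ.encode = l ++ (φ[j].length :: φ[j].map litCode) ++ l' ∧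
      l.length = φ.clausePos j := by
  refine ⟨n :: φ.length :: (φ.take j).flatMap fun C => C.length :: C.map litCode,
    (φ.drop (j + 1)).flatMap fun C => C.length :: C.map litCode, ?_, ?_⟩
  · have h : ∀ f : List (Fin n × Bool) → List ℕ, φ.flatMap f =
        (φ.take j).flatMap f ++ f φ[j] ++ (φ.drop (j + 1)).flatMap f := by
      intro f
      conv_lhs => rw [← List.take_append_drop j φ, List.drop_eq_getElem_cons hj]
      rw [List.flatMap_append, List.flatMap_cons, List.append_assoc]
    have e : φ.encode = n :: φ.length :: φ.flatMap fun C => C.length :: C.map litCode := rfl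
    rw [e, h]
    rfl
  · simp [clausePos]; omega

theorem encode_clausePos {j : ℕ} (hj : j < φ.length) :
    φ.encode.getD (φ.clausePos j) 0 = φ[j].length := by
  obtain ⟨l, l', h, hl⟩ := φ.encode_split hj
  rw [h, ← hl]
  simp

theorem encode_literal {j k : ℕ} (hj : j < φ.length) (hk : k < φ[j].length) :
    φ.encode.getD (φ.clausePos j + 1 + k) 0 = litCode φ[j][k] := by
  obtain ⟨l, l', h, hl⟩ := φ.encode_split hj
  rw [h, ← hl, List.append_assoc, List.getD_append_right _ _ _ _ (by omega),
    List.getD_append _ _ _ _ (by simp; omega), show l.length + 1 + k - l.length = k + 1 by omega]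
  simp [hk]

theorem clausePos_add_le {j : ℕ} (hj : j < φ.length) :
    φ.clausePos j + 1 + φ[j].length ≤ φ.encode.length := by
  obtain ⟨l, l', h, hl⟩ := φ.encode_split hj
  rw [h, ← hl]
  simp only [List.length_append, List.length_cons, List.length_map]
  omega

end CNFFormula

namespace QuadGraph

open RAM RAM.Expr RAM.Program CNFFormula

/-- Not `0` if the expressions have equal values. -/
def eqE (e₁ e₂ : Expr) : Expr := sub (const 1) (add (sub e₁ e₂) (sub e₂ e₁))

/-- Not `0` if the partial assignment in register `21` satisfies the literal at the position in
register `17` of the input. -/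
def satE : Expr :=
  mul (eqE (mod (reg 21) (const 4)) (mod (div (get 0 (reg 17)) (const 2)) (const 4)))
    (eqE (mod (div (div (reg 21) (const 4))
        (get 1 (div (div (get 0 (reg 17)) (const 2)) (const 4)))) (const 2))
      (mod (get 0 (reg 17)) (const 2)))

/-- Process one literal. -/
def scanBody : Program :=
  seq (branch satE (set 20 (const 1)) skip) <|
  seq (set 17 (add (reg 17) (const 1))) <|
  set 19 (sub (reg 19) (const 1))

/-- Process one clause. -/
def clauseBody : Program :=
  seq (set 19 (get 0 (reg 17))) <|
  seq (set 17 (add (reg 17) (const 1))) <|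
  seq (set 20 (const 0)) <|
  seq (loop (reg 19) scanBody) <|
  seq (put 2 (add (mul (reg 21) (reg 2)) (reg 18)) (reg 20)) <|
  set 18 (add (reg 18) (const 1))

/-- Process one partial assignment. -/
def vectorBody : Program :=
  seq (set 17 (const 2)) <|
  seq (set 18 (const 0)) <|
  seq (loop (sub (reg 15) (reg 18)) clauseBody) <|
  seq (put 2 (add (mul (reg 21) (reg 2)) (add (reg 15) (mod (reg 21) (const 4)))) (const 1)) <|
  set 21 (add (reg 21) (const 1))

/-- One more power of two. -/
def powerBody : Program :=
  seq (put 1 (reg 24) (reg 23)) <|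
  seq (set 23 (mul (const 2) (reg 23))) <|
  set 24 (add (reg 24) (const 1))

/-- Read the formula and prepare all tables. -/
def setup : Program :=
  seq (set 15 (get 0 (const 1))) <|
  seq (set 22 (div (add (get 0 (const 0)) (const 3)) (const 4))) <|
  seq (set 23 (const 1)) <|
  seq (loop (sub (reg 22) (reg 24)) powerBody) <|
  seq (set 1 (mul (const 4) (reg 23))) <|
  seq (set 2 (add (reg 15) (const 4))) <|
  seq (set 3 (powE 5)) <|
  seq (set 4 (add cubeE (add (mul (mul (reg 1) (reg 1)) (reg 3))
    (mul (mul (reg 1) (reg 1)) (reg 3))))) <|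
  seq (set 5 (mul cubeE (mul (reg 3) (reg 3)))) <|
  seq (loop (sub (reg 1) (reg 21)) vectorBody) <|
  put 32 (const 0) (reg 4)

variable {n M : ℕ} {φ : CNFFormula n} {s : State}

/-- The constants of the reduction for the formula `φ` are in place. -/
structure Prepared (φ : CNFFormula n) (s : State) : Prop where
  reg1 : s.reg 1 = numVec n
  reg2 : s.reg 2 = φ.dim
  reg3 : s.reg 3 = φ.dim ^ 5
  reg4 : s.reg 4 = order (numVec n) φ.dim
  reg5 : s.reg 5 = numVec n * numVec n * numVec n * (φ.dim ^ 5 * φ.dim ^ 5)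
  reg6 : s.reg 6 = 0
  reg7 : s.reg 7 = 0
  reg15 : s.reg 15 = φ.length
  input : s.arr 0 = fun i => φ.encode.getD i 0
  pow : ∀ k < blockSize n, s.arr 1 k = 2 ^ k
  arr3 : s.arr 3 = fun _ => 0
  clean_reg : ∀ x, 32 ≤ x → s.reg x = 0
  clean_arr : ∀ a, 32 ≤ a → s.arr a = fun _ => 0

theorem Prepared.setReg (h : Prepared φ s) {x v : ℕ} (hx : 17 ≤ x) (hx' : x < 32) :
    Prepared φ (s.setReg x v) := by
  constructor
  case clean_reg =>
    intro y hy
    rw [State.setReg_reg, if_neg (by omega)]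
    exact h.clean_reg y hy
  all_goals try rw [State.setReg_reg, if_neg (by omega)]
  exacts [h.reg1, h.reg2, h.reg3, h.reg4, h.reg5, h.reg6, h.reg7, h.reg15, h.input, h.pow, h.arr3,
    h.clean_arr]

theorem Prepared.setTable (h : Prepared φ s) (j v : ℕ) : Prepared φ (s.setArr 2 j v) where
  reg1 := h.reg1
  reg2 := h.reg2
  reg3 := h.reg3
  reg4 := h.reg4
  reg5 := h.reg5
  reg6 := h.reg6
  reg7 := h.reg7
  reg15 := h.reg15
  input := by simpa using h.input
  pow k hk := by simpa using h.pow k hk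
  arr3 := by simpa using h.arr3
  clean_reg := h.clean_reg
  clean_arr a ha := by
    have : a ≠ 2 := by omega
    simpa [this] using h.clean_arr a ha

theorem eval_eqE (e₁ e₂ : Expr) : (eqE e₁ e₂).eval s ≠ 0 ↔ e₁.eval s = e₂.eval s := by
  simp only [eqE, Expr.eval]
  omega

/-- Halving a literal code gives the variable and its parity gives the sign; the bit of the
assignment is extracted by dividing by a tabulated power of two. -/
theorem eval_satE (h : Prepared φ s) {l : Fin n × Bool}
    (hl : s.arr 0 (s.reg 17) = litCode l) : satE.eval s ≠ 0 ↔ satLit (s.reg 21) l = true := by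
  have h₁ : litCode l / 2 = l.1 := by simp only [litCode]; split_ifs <;> omega
  have h₂ : litCode l % 2 = if l.2 then 1 else 0 := by simp only [litCode]; split_ifs <;> omega
  have h₃ : s.arr 1 ((l.1 : ℕ) / 4) = 2 ^ ((l.1 : ℕ) / 4) :=
    h.pow _ (by have := l.1.2; simp only [blockSize]; omega)
  rw [satE, Expr.eval, mul_ne_zero_iff, eval_eqE, eval_eqE]
  simp only [Expr.eval, hl, h₁, h₂, h₃, satLit, decide_eq_true_eq]

/-- State while a clause is read: `k` literals are done. -/
structure Scanning (φ : CNFFormula n) (T : ℕ → ℕ) (v j : ℕ) (hj : j < φ.length) (k : ℕ)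
    (s : State) : Prop where
  prepared : Prepared φ s
  table : s.arr 2 = T
  reg17 : s.reg 17 = φ.clausePos j + 1 + k
  reg18 : s.reg 18 = j
  reg19 : s.reg 19 = φ[j].length - k
  reg20 : s.reg 20 = ((φ[j].take k).any (satLit v)).toNat
  reg21 : s.reg 21 = v

theorem scanBody_run (hs : s.Bounded M) {T : ℕ → ℕ} {v j k : ℕ} {hj : j < φ.length}
    (hM : φ.encode.length ≤ M) (hk : k < φ[j].length) (h : Scanning φ T v j hj k s) :
    Run M scanBody s scanBody.charge (Scanning φ T v j hj (k + 1)) := by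
  have hp := φ.clausePos_add_le hj
  have hM₂ := hs.two_le
  have hlit : s.arr 0 (s.reg 17) = litCode φ[j][k] := by
    rw [h.prepared.input, h.reg17]; exact φ.encode_literal hj hk
  have hsat := eval_satE h.prepared hlit
  rw [h.reg21] at hsat
  have hany : (φ[j].take (k + 1)).any (satLit v) =
      ((φ[j].take k).any (satLit v) || satLit v φ[j][k]) := by
    simp only [List.take_add_one, List.getElem?_eq_getElem hk, List.any_append,
      Option.toList_some, List.any_cons, List.any_nil, Bool.or_false]
  refine Run.seq (Q := Scanning φ T v j hj (k + 1)) (c₁ := (branch satE (set 20 (const 1)) skip).charge) ?_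
  have key : Run M (branch satE (set 20 (const 1)) skip) s
      (branch satE (set 20 (const 1)) skip).charge fun s' =>
      s'.reg 20 = ((φ[j].take (k + 1)).any (satLit v)).toNat ∧
      (∀ x, x ≠ 20 → s'.reg x = s.reg x) ∧ s'.arr = s.arr ∧ Prepared φ s' := by
    refine Run.branch hs (fun hb => .set hs (v := 1) rfl (by omega) fun _ => ?_)
      fun hb => .skip hs ?_
    · refine ⟨?_, fun x hx => by simp [hx], rfl, h.prepared.setReg (by norm_num) (by norm_num)⟩
      simp [hany, hsat.1 hb]
    · refine ⟨?_, fun _ _ => rfl, rfl, h.prepared⟩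
      have : satLit v φ[j][k] = false := by
        by_contra hc
        exact hsat.2 (by simpa using hc) hb
      rw [hany, this, h.reg20, Bool.or_false]
  refine key.mono le_rfl ?_
  rintro s₁ hs₁ ⟨h₂₀, hreg, harr, hP⟩ -
  refine .set_seq (v := φ.clausePos j + 1 + (k + 1)) hs₁
    (by simp only [Expr.eval]; rw [hreg _ (by norm_num), h.reg17]; rfl) (by omega) fun hs₂ => ?_
  refine .set (v := φ[j].length - (k + 1)) hs₂
    (by simp only [Expr.eval, State.setReg_reg]; norm_num; rw [hreg _ (by norm_num), h.reg19]; rfl)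
    (by omega) fun _ => ?_
  refine ⟨(hP.setReg (by norm_num) (by norm_num)).setReg (by norm_num) (by norm_num), ?_, ?_, ?_,
    ?_, ?_, ?_⟩
  · simpa [harr] using h.table
  · simp
  · simpa [hreg] using h.reg18
  · simp
  · simpa using h₂₀
  · simpa [hreg] using h.reg21

/-- Time for one literal. -/
def scanTime : ℕ := (reg 19).charge + 1 + scanBody.charge

theorem scan_run (hs : s.Bounded M) {T : ℕ → ℕ} {v j L : ℕ} {hj : j < φ.length}
    (hM : φ.encode.length ≤ M) (hL : φ[j].length ≤ L) (h : Scanning φ T v j hj 0 s) :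
    Run M (loop (reg 19) scanBody) s (scanTime * (L + 1)) (Scanning φ T v j hj φ[j].length) := by
  refine (Run.loop (Scanning φ T v j hj) φ[j].length hs h
    (fun i hi s hs h => ⟨by rw [Expr.eval, h.reg19]; omega, scanBody_run hs hM hi h⟩)
    fun s _ h => by rw [Expr.eval, h.reg19]; omega).mono ?_ fun _ _ h => h
  rw [← scanTime, mul_add, mul_comm, mul_one]
  exact add_le_add (Nat.mul_le_mul_left _ hL) (by rw [scanTime]; omega)

/-- The table is filled for the vectors before `v`, and for the coordinates of `v` before `j`. -/
def TableUpTo (φ : CNFFormula n) (v j : ℕ) (T : ℕ → ℕ) : Prop :=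
  ∀ w k, k < φ.dim → T (w * φ.dim + k) =
    if w < v ∨ w = v ∧ k < j then (φ.sat w k).toNat else 0

/-- State after `j` clauses for the vector `v`. -/
structure Filling (φ : CNFFormula n) (v j : ℕ) (s : State) : Prop where
  prepared : Prepared φ s
  table : TableUpTo φ v j (s.arr 2)
  reg17 : s.reg 17 = φ.clausePos j
  reg18 : s.reg 18 = j
  reg21 : s.reg 21 = v

theorem addr_eq_iff {d w k w' k' : ℕ} (hk : k < d) (hk' : k' < d) :
    w * d + k = w' * d + k' ↔ w = w' ∧ k = k' := by
  constructor
  · intro h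
    have h₁ : w = w' := by
      have := congrArg (· / d) h
      simpa [Nat.mul_comm _ d, Nat.mul_add_div (by omega : d > 0), Nat.div_eq_of_lt, hk, hk']
        using this
    subst h₁
    exact ⟨rfl, by omega⟩
  · rintro ⟨rfl, rfl⟩; rfl

theorem TableUpTo.update {v j : ℕ} {T : ℕ → ℕ} (h : TableUpTo φ v j T) (hj : j < φ.dim) :
    TableUpTo φ v (j + 1) (Function.update T (v * φ.dim + j) (φ.sat v j).toNat) := by
  intro w k hk
  rw [Function.update_apply]
  by_cases hc : w = v ∧ k = j
  · obtain ⟨rfl, rfl⟩ := hc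
    rw [if_pos rfl, if_pos (.inr ⟨rfl, by omega⟩)]
  · rw [if_neg (by rwa [addr_eq_iff hk hj]), h w k hk]
    congr 1
    simp only [eq_iff_iff]
    omega

/-- Time for one clause. -/
def clauseTime : ℕ :=
  (set 19 (get 0 (reg 17))).charge + (set 17 (add (reg 17) (const 1))).charge +
  (set 20 (const 0)).charge + scanTime +
  (put 2 (add (mul (reg 21) (reg 2)) (reg 18)) (reg 20)).charge +
  (set 18 (add (reg 18) (const 1))).charge

theorem clauseBody_run (hs : s.Bounded M) {v j L : ℕ} (hj : j < φ.length)
    (hM : φ.encode.length ≤ M) (hm : φ.length ≤ M) (hL : ∀ C ∈ φ, C.length ≤ L)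
    (h : Filling φ v j s) :
    Run M clauseBody s (clauseTime * (L + 1)) (Filling φ v (j + 1)) := by
  have hp := φ.clausePos_add_le hj
  have hM₂ := hs.two_le
  suffices H : Run M clauseBody s
      ((set 19 (get 0 (reg 17))).charge + ((set 17 (add (reg 17) (const 1))).charge +
      ((set 20 (const 0)).charge + (scanTime * (L + 1) +
      ((put 2 (add (mul (reg 21) (reg 2)) (reg 18)) (reg 20)).charge +
      (set 18 (add (reg 18) (const 1))).charge))))) (Filling φ v (j + 1)) by
    refine H.mono ?_ fun _ _ h => h
    rw [clauseTime]
    nlinarith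
  refine .set_seq (v := φ[j].length) hs
    (by rw [Expr.eval, Expr.eval, h.prepared.input, h.reg17]; exact φ.encode_clausePos hj)
    (by omega) fun hs => ?_
  refine .set_seq (v := φ.clausePos j + 1 + 0) hs (by simp [Expr.eval, h.reg17]) (by omega)
    fun hs => ?_
  refine .set_seq (v := 0) hs rfl (by omega) fun hs => ?_
  refine Run.seq ((scan_run (φ := φ) (T := s.arr 2) (v := v) (hj := hj) hs hM
    (hL _ (List.getElem_mem hj)) ?_).mono le_rfl ?_)
  · refine ⟨((h.prepared.setReg (by norm_num) (by norm_num)).setReg (by norm_num)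
      (by norm_num)).setReg (by norm_num) (by norm_num), by simp, by simp, by simp [h.reg18],
      by simp, by simp, by simp [h.reg21]⟩
  · intro s₁ _ h₁ hs₁
    have hsat : φ.sat v j = φ[j].any (satLit v) := by simp [CNFFormula.sat, hj]
    have h₂₀ := h₁.reg20
    rw [List.take_length, ← hsat] at h₂₀
    refine .put_seq (j := v * φ.dim + j) (v := (φ.sat v j).toNat) hs₁
      (by simp [Expr.eval, h₁.reg21, h₁.prepared.reg2, h₁.reg18]) h₂₀
      ((Bool.toNat_le _).trans (by omega)) fun hs₂ => ?_
    refine .set (v := j + 1) hs₂ (by simp [Expr.eval, h₁.reg18]) (by omega) fun _ => ?_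
    refine ⟨(h₁.prepared.setTable _ _).setReg (by norm_num) (by norm_num), ?_, ?_, by simp,
      by simp [h₁.reg21]⟩
    · have := h.table.update (j := j) (by simp only [dim]; omega)
      simpa [h₁.table] using this
    · simp [h₁.reg17, φ.clausePos_succ hj]

/-- Time for the clauses of one vector, per clause. -/
def clausesTime : ℕ := (sub (reg 15) (reg 18)).charge + 1 + clauseTime

theorem clauses_run (hs : s.Bounded M) {v L : ℕ}
    (hM : φ.encode.length ≤ M) (hm : φ.length ≤ M) (hL : ∀ C ∈ φ, C.length ≤ L)
    (h : Filling φ v 0 s) :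
    Run M (loop (sub (reg 15) (reg 18)) clauseBody) s
      (clausesTime * ((φ.length + 1) * (L + 1))) (Filling φ v φ.length) := by
  refine (Run.loop (Filling φ v) φ.length hs h
    (fun i hi s hs h => ⟨by rw [Expr.eval, Expr.eval, Expr.eval, h.reg18, h.prepared.reg15]; omega,
      clauseBody_run hs hi hM hm hL h⟩)
    fun s _ h => by rw [Expr.eval, Expr.eval, Expr.eval, h.reg18, h.prepared.reg15]; omega).mono ?_
      fun _ _ h => h
  rw [clausesTime]
  generalize (sub (reg 15) (reg 18)).charge + 1 = b
  have h₁ : b + clauseTime * (L + 1) ≤ (b + clauseTime) * (L + 1) := by nlinarith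
  calc φ.length * (b + clauseTime * (L + 1)) + b
      ≤ φ.length * ((b + clauseTime) * (L + 1)) + (b + clauseTime) * (L + 1) :=
        add_le_add (Nat.mul_le_mul_left _ h₁) (by nlinarith)
    _ = _ := by ring

/-- State when `v` vectors are finished. -/
structure Tabulating (φ : CNFFormula n) (v : ℕ) (s : State) : Prop where
  prepared : Prepared φ s
  table : TableUpTo φ v 0 (s.arr 2)
  reg21 : s.reg 21 = v

/-- Time for one vector, per clause. -/
def vectorTime : ℕ :=
  (set 17 (const 2)).charge + (set 18 (const 0)).charge + clausesTime +
  (put 2 (add (mul (reg 21) (reg 2)) (add (reg 15) (mod (reg 21) (const 4)))) (const 1)).charge +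
  (set 21 (add (reg 21) (const 1))).charge

theorem vectorBody_run (hs : s.Bounded M) {v L : ℕ} (hM : φ.encode.length ≤ M)
    (hm : φ.length ≤ M) (hv : v + 1 ≤ M) (hL : ∀ C ∈ φ, C.length ≤ L) (h : Tabulating φ v s) :
    Run M vectorBody s (vectorTime * ((φ.length + 1) * (L + 1))) (Tabulating φ (v + 1)) := by
  have hM₂ := hs.two_le
  suffices H : Run M vectorBody s
      ((set 17 (const 2)).charge + ((set 18 (const 0)).charge +
      (clausesTime * ((φ.length + 1) * (L + 1)) +
      ((put 2 (add (mul (reg 21) (reg 2)) (add (reg 15) (mod (reg 21) (const 4))))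
        (const 1)).charge + (set 21 (add (reg 21) (const 1))).charge))))
      (Tabulating φ (v + 1)) by
    refine H.mono ?_ fun _ _ h => h
    rw [vectorTime]
    have : 1 ≤ (φ.length + 1) * (L + 1) := Nat.succ_le_of_lt (by positivity)
    generalize (φ.length + 1) * (L + 1) = X at this
    nlinarith
  refine .set_seq (v := 2) hs rfl (by omega) fun hs => ?_
  refine .set_seq (v := 0) hs rfl (by omega) fun hs => ?_
  refine Run.seq ((clauses_run (φ := φ) (v := v) hs hM hm hL ?_).mono le_rfl ?_)
  · exact ⟨(h.prepared.setReg (by norm_num) (by norm_num)).setReg (by norm_num) (by norm_num),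
      by simpa using h.table, by simp [clausePos_zero], by simp, by simp [h.reg21]⟩
  · intro s₁ _ h₁ hs₁
    refine .put_seq (j := v * φ.dim + (φ.length + v % 4)) (v := 1) hs₁
      (by simp [Expr.eval, h₁.reg21, h₁.prepared.reg2, h₁.prepared.reg15]) rfl (by omega)
      fun hs₂ => ?_
    refine .set (v := v + 1) hs₂ (by simp [Expr.eval, h₁.reg21]) hv fun _ => ?_
    refine ⟨(h₁.prepared.setTable _ _).setReg (by norm_num) (by norm_num), ?_, by simp⟩
    intro w k hk
    have ht := h₁.table w k hk
    have hd : φ.length + v % 4 < φ.dim := by simp only [dim]; omega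
    simp only [State.setReg_arr, State.setArr_arr, if_true, Function.update_apply,
      addr_eq_iff hk hd, ht]
    by_cases hw : w = v
    · subst hw
      by_cases hkm : k < φ.length
      · rw [if_neg (by omega), if_pos (by omega), if_pos (by omega)]
      -- Among the block coordinates only the vector's own is written; the others keep the initial
      -- `0`, which is why `TableUpTo` records zeros in unprocessed cells.
      · have : φ.sat w k = decide (k = φ.length + w % 4) := by simp [CNFFormula.sat, hkm]
        rw [if_pos (.inl (by omega : w < w + 1) : w < w + 1 ∨ w = w + 1 ∧ k < 0), this,
          if_neg (by omega : ¬ (w < w ∨ w = w ∧ k < φ.length))]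
        by_cases hk' : k = φ.length + w % 4 <;> simp [hk']
    · simp only [hw, false_and, if_false, or_false]
      congr 1
      simp only [eq_iff_iff]
      omega

/-- Time for the table, per vector and clause. -/
def tableTime : ℕ := (sub (reg 1) (reg 21)).charge + 1 + vectorTime

theorem table_run (hs : s.Bounded M) {L : ℕ} (hM : φ.encode.length ≤ M)
    (hm : φ.length ≤ M) (hN : numVec n ≤ M) (hL : ∀ C ∈ φ, C.length ≤ L)
    (h : Tabulating φ 0 s) :
    Run M (loop (sub (reg 1) (reg 21)) vectorBody) s
      (tableTime * ((numVec n + 1) * ((φ.length + 1) * (L + 1)))) (Tabulating φ (numVec n)) := by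
  refine (Run.loop (Tabulating φ) (numVec n) hs h
    (fun i hi s hs h => ⟨by rw [Expr.eval, Expr.eval, Expr.eval, h.reg21, h.prepared.reg1]; omega,
      vectorBody_run hs hM hm (by omega) hL h⟩)
    fun s _ h => by rw [Expr.eval, Expr.eval, Expr.eval, h.reg21, h.prepared.reg1]; omega).mono ?_
      fun _ _ h => h
  rw [tableTime]
  have hX : 1 ≤ (φ.length + 1) * (L + 1) := Nat.succ_le_of_lt (by positivity)
  generalize (φ.length + 1) * (L + 1) = X at hX
  generalize (sub (reg 1) (reg 21)).charge + 1 = b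
  have h₁ : b + vectorTime * X ≤ (b + vectorTime) * X := by nlinarith
  calc numVec n * (b + vectorTime * X) + b
      ≤ numVec n * ((b + vectorTime) * X) + (b + vectorTime) * X :=
        add_le_add (Nat.mul_le_mul_left _ h₁) (by nlinarith)
    _ = _ := by ring

end QuadGraph

/-! ### Powers of two, and the complete preparation -/

namespace QuadGraph

open RAM RAM.Expr RAM.Program CNFFormula

variable {n M : ℕ} {φ : CNFFormula n} {s : State}

/-- State when `k` powers of two are computed. -/
structure Powers (φ : CNFFormula n) (k : ℕ) (s : State) : Prop where
  reg15 : s.reg 15 = φ.length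
  reg22 : s.reg 22 = blockSize n
  reg23 : s.reg 23 = 2 ^ k
  reg24 : s.reg 24 = k
  clean_reg : ∀ x, x ≠ 15 → x ≠ 22 → x ≠ 23 → x ≠ 24 → s.reg x = 0
  input : s.arr 0 = fun i => φ.encode.getD i 0
  pow : ∀ i < k, s.arr 1 i = 2 ^ i
  clean_arr : ∀ a, 2 ≤ a → s.arr a = fun _ => 0

theorem powerBody_run (hs : s.Bounded M) {k : ℕ} (hM : 2 ^ (k + 1) ≤ M) (h : Powers φ k s) :
    Run M powerBody s powerBody.charge (Powers φ (k + 1)) := by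
  have hk : k + 1 < 2 ^ (k + 1) := Nat.lt_two_pow_self
  have h₂ : 2 ^ k ≤ 2 ^ (k + 1) := Nat.pow_le_pow_right (by norm_num) (by omega)
  refine .put_seq (j := k) (v := 2 ^ k) hs (by simp [Expr.eval, h.reg24])
    (by simp [Expr.eval, h.reg23]) (by omega) fun hs => ?_
  refine .set_seq (v := 2 ^ (k + 1)) hs (by simp [Expr.eval, h.reg23, pow_succ']) hM fun hs => ?_
  refine .set (v := k + 1) hs (by simp [Expr.eval, h.reg24]) (by omega) fun _ => ?_
  refine ⟨by simp [h.reg15], by simp [h.reg22], by simp, by simp, ?_, by simp [h.input], ?_, ?_⟩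
  · intro x h₁ h₂ h₃ h₄
    simpa [h₃, h₄] using h.clean_reg x h₁ h₂ h₃ h₄
  · intro i hi
    simp only [State.setReg_arr, State.setArr_arr, if_true, Function.update_apply]
    split_ifs with hik
    · rw [hik]
    · exact h.pow i (by omega)
  · intro a ha
    have : a ≠ 1 := by omega
    simpa [this] using h.clean_arr a ha

/-- Time for one power of two. -/
def powerTime : ℕ := (sub (reg 22) (reg 24)).charge + 1 + powerBody.charge

theorem powers_run (hs : s.Bounded M) (hM : 2 ^ blockSize n ≤ M) (h : Powers φ 0 s) :
    Run M (loop (sub (reg 22) (reg 24)) powerBody) s (powerTime * (blockSize n + 1))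
      (Powers φ (blockSize n)) := by
  refine (Run.loop (Powers φ) (blockSize n) hs h
    (fun i hi s hs h => ⟨by rw [Expr.eval, Expr.eval, Expr.eval, h.reg22, h.reg24]; omega,
      powerBody_run hs ((Nat.pow_le_pow_right (by norm_num) hi).trans hM) h⟩)
    fun s _ h => by rw [Expr.eval, Expr.eval, Expr.eval, h.reg22, h.reg24]; omega).mono ?_
      fun _ _ h => h
  rw [← powerTime, mul_add, mul_comm, mul_one]
  exact add_le_add le_rfl (by rw [powerTime]; omega)

theorem numVec_pos (n : ℕ) : 0 < numVec n := by simp [numVec]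

theorem dim_pos (φ : CNFFormula n) : 0 < φ.dim := by simp [dim]

/-- The table stores satisfied clauses, that is, the complement of `vec`. With the number of
vertices in cell 0, array `32` encodes the graph without edges, since its count cell is still `0`.
-/
theorem Tabulating.rounds (h : Tabulating φ (numVec n) s) :
    Rounds φ.vec (numVec_pos n) (dim_pos φ) 0
      (s.setArr 32 0 (order (numVec n) φ.dim)) := by
  have hP := h.prepared
  refine ⟨hP.reg1, hP.reg2, hP.reg3, hP.reg4, hP.reg5, hP.reg6, [], by simp, ?_, by simp [edgesOf]⟩
  refine ⟨hP.reg7, fun v j => ?_, fun u v => by simp [hP.arr3, edgesOf], ?_, hP.clean_reg,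
    fun a ha => ?_, by simp [edgesOf]⟩
  · have := h.table v j j.2
    rw [if_pos (.inl v.2)] at this
    simpa [vec] using this
  · funext i
    have := hP.clean_arr 32 le_rfl
    simp only [State.setArr_arr, if_true, this, encodeGraph, Function.update_apply]
    rcases i with _ | _ | i <;> simp
  · have : a ≠ 32 := by omega
    simpa [this] using hP.clean_arr a (by omega)

/-- Time for the preparations, per vector and clause. -/
def setupTime : ℕ :=
  (set 15 (get 0 (const 1))).charge +
  (set 22 (div (add (get 0 (const 0)) (const 3)) (const 4))).charge +
  (set 23 (const 1)).charge + powerTime + (set 1 (mul (const 4) (reg 23))).charge +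
  (set 2 (add (reg 15) (const 4))).charge + (set 3 (powE 5)).charge +
  (set 4 (add cubeE (add (mul (mul (reg 1) (reg 1)) (reg 3))
    (mul (mul (reg 1) (reg 1)) (reg 3))))).charge +
  (set 5 (mul cubeE (mul (reg 3) (reg 3)))).charge + tableTime + (put 32 (const 0) (reg 4)).charge

theorem setup_run {L : ℕ} (hs : (start φ.encode).Bounded M) (hM : φ.encode.length ≤ M)
    (hI : numVec n * numVec n * numVec n * (φ.dim ^ 5 * φ.dim ^ 5) ≤ M)
    (hV : order (numVec n) φ.dim ≤ M) (hD : φ.dim ^ 5 ≤ M) (hN : numVec n ≤ M)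
    (hL : ∀ C ∈ φ, C.length ≤ L) :
    Run M setup (start φ.encode)
      (setupTime * ((numVec n + 1) * ((φ.length + 1) * (L + 1))))
      (Rounds φ.vec (numVec_pos n) (dim_pos φ) 0) := by
  have hM₂ := hs.two_le
  have hd : φ.dim ≤ M := (Nat.le_self_pow (by norm_num) _).trans hD
  have hm : φ.length ≤ M := le_trans (by simp [dim]) hd
  have hh : 2 ^ blockSize n ≤ M := le_trans (by simp only [numVec]; omega) hN
  have hb : blockSize n < 2 ^ blockSize n := Nat.lt_two_pow_self
  -- The nested sum is the shape produced by sequencing; each constant charge is then absorbed into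
  -- a multiple of the product, which is at least 1.
  suffices H : Run M setup (start φ.encode)
      ((set 15 (get 0 (const 1))).charge +
      ((set 22 (div (add (get 0 (const 0)) (const 3)) (const 4))).charge +
      ((set 23 (const 1)).charge + (powerTime * (blockSize n + 1) +
      ((set 1 (mul (const 4) (reg 23))).charge +
      ((set 2 (add (reg 15) (const 4))).charge + ((set 3 (powE 5)).charge +
      ((set 4 (add cubeE (add (mul (mul (reg 1) (reg 1)) (reg 3))
        (mul (mul (reg 1) (reg 1)) (reg 3))))).charge +
      ((set 5 (mul cubeE (mul (reg 3) (reg 3)))).charge +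
      (tableTime * ((numVec n + 1) * ((φ.length + 1) * (L + 1))) +
      (put 32 (const 0) (reg 4)).charge))))))))))
      (Rounds φ.vec (numVec_pos n) (dim_pos φ) 0) by
    refine H.mono ?_ fun _ _ h => h
    have hX : blockSize n + 1 ≤ (numVec n + 1) * ((φ.length + 1) * (L + 1)) := by
      have h₁ : blockSize n + 1 ≤ numVec n + 1 := by simp only [numVec]; omega
      have h₂ : 1 ≤ (φ.length + 1) * (L + 1) := Nat.succ_le_of_lt (by positivity)
      nlinarith
    rw [setupTime]
    generalize (numVec n + 1) * ((φ.length + 1) * (L + 1)) = X at hX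
    have hX₁ : 1 ≤ X := by omega
    have h₁ := Nat.mul_le_mul_left powerTime hX
    have absorb : ∀ a, a ≤ a * X := fun a => Nat.le_mul_of_pos_right a hX₁
    simp only [add_mul]
    linarith [absorb (set 15 (get 0 (const 1))).charge,
      absorb (set 22 (div (add (get 0 (const 0)) (const 3)) (const 4))).charge,
      absorb (set 23 (const 1)).charge, absorb (set 1 (mul (const 4) (reg 23))).charge,
      absorb (set 2 (add (reg 15) (const 4))).charge, absorb (set 3 (powE 5)).charge,
      absorb (set 4 (add cubeE (add (mul (mul (reg 1) (reg 1)) (reg 3))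
        (mul (mul (reg 1) (reg 1)) (reg 3))))).charge,
      absorb (set 5 (mul cubeE (mul (reg 3) (reg 3)))).charge,
      absorb (put 32 (const 0) (reg 4)).charge]
  refine .set_seq (v := φ.length) hs (by simp [Expr.eval, start, encode]) hm fun hs => ?_
  refine .set_seq (v := blockSize n) hs (by simp [Expr.eval, start, encode, blockSize]) (by omega)
    fun hs => ?_
  refine .set_seq (v := 1) hs rfl (by omega) fun hs => ?_
  refine Run.seq ((powers_run (φ := φ) hs hh ?_).mono le_rfl ?_)
  · refine ⟨by simp, by simp, by simp, by simp [start], fun x h₁ h₂ h₃ _ => ?_, by simp [start],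
      by simp, fun a ha => ?_⟩
    · simp [h₁, h₂, h₃, start]
    · have : a ≠ 0 := by omega
      simp [start, this]
  intro s _ h hs
  have h0 : ∀ x, x ≠ 15 → x ≠ 22 → x ≠ 23 → x ≠ 24 → s.reg x = 0 := h.clean_reg
  refine .set_seq (v := numVec n) hs (by simp [Expr.eval, h.reg23, numVec]) hN fun hs => ?_
  refine .set_seq (v := φ.dim) hs (by simp [Expr.eval, h.reg15, dim]) hd fun hs => ?_
  refine .set_seq (v := φ.dim ^ 5) hs (eval_powE (by simp) 5) hD fun hs => ?_
  refine .set_seq (v := order (numVec n) φ.dim) hs (by simp [Expr.eval, cubeE, order]) hV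
    fun hs => ?_
  refine .set_seq (v := numVec n * numVec n * numVec n * (φ.dim ^ 5 * φ.dim ^ 5)) hs
    (by simp [Expr.eval, cubeE]) hI fun hs => ?_
  refine Run.seq ((table_run (φ := φ) hs hM hm hN hL ?_).mono le_rfl ?_)
  · refine ⟨⟨by simp, by simp, by simp, by simp, by simp, ?_, ?_, by simp [h.reg15],
      by simp [h.input], by simpa using h.pow, ?_, fun x hx => ?_, fun a ha => ?_⟩, ?_, ?_⟩
    · simp [h.clean_reg]
    · simp [h.clean_reg]
    · simpa using h.clean_arr 3 (by norm_num)
    · simp only [State.setReg_reg]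
      rw [if_neg (by omega), if_neg (by omega), if_neg (by omega), if_neg (by omega),
        if_neg (by omega)]
      exact h.clean_reg x (by omega) (by omega) (by omega) (by omega)
    · simpa using h.clean_arr a (by omega)
    · intro w k _
      simp [h.clean_arr 2 le_rfl]
    · simp [h.clean_reg]
  · intro s₁ _ h₁ hs₁
    exact .put (j := 0) (v := order (numVec n) φ.dim) hs₁ rfl
      (by simp [Expr.eval, h₁.prepared.reg4]) hV fun _ => h₁.rounds

end QuadGraph

/-! ## The reduction -/

namespace RAM

theorem Expr.size_eval_lt_cost (s : State) (e : Expr) : Nat.size (e.eval s) < e.cost s := by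
  cases e <;> simp only [Expr.cost, Expr.eval] <;> omega

/-- A program has no time to write a long number to a register. -/
theorem Exec.size_reg_le {p : Program} {s s' : State} {t : ℕ} (h : Exec p s s' t) (x : ℕ) :
    Nat.size (s'.reg x) ≤ Nat.size (s.reg x) + t := by
  induction h with
  | skip => omega
  | set y e s =>
    have := e.size_eval_lt_cost s
    simp only [Function.update_apply]
    split_ifs <;> omega
  | put => simp only; omega
  | seq _ _ ih₁ ih₂ => omega
  | branch_true _ _ ih => omega
  | branch_false _ _ ih => omega
  | loop_done => omega
  | loop_step _ _ _ ih₁ ih₂ => omega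

end RAM

namespace QuadGraph

open RAM RAM.Expr RAM.Program CNFFormula

/-- Decide satisfiability with a program `P` that approximates the diameter. -/
def reduction (P : Program) : Program :=
  seq (seq setup buildLoop) (seq (P.shift 32) (set 0 (sub (reg 32) (mul (const 4) (reg 33)))))

/-- The number of rounds of the reduction. -/
def rounds {n : ℕ} (φ : CNFFormula n) : ℕ :=
  numVec n * numVec n * numVec n * (φ.dim ^ 5 * φ.dim ^ 5)

/-- Factor in the time for writing down the graph. -/
def buildTime : ℕ :=
  4 * setupTime + (((sub (reg 5) (reg 6)).charge + 1 + round.charge) +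
    ((sub (reg 5) (reg 6)).charge + 1))

variable {n : ℕ} (φ : CNFFormula n)

theorem lt_numVec (n : ℕ) : n < numVec n := by
  have : blockSize n < 2 ^ blockSize n := Nat.lt_two_pow_self
  simp only [numVec]
  simp only [blockSize] at this ⊢
  omega

theorem length_le {C : List (Fin n × Bool)} (h : C.Nodup) : C.length ≤ 2 * n := by
  have := h.length_le_card
  simpa [mul_comm] using this

theorem encode_length_le (h : ∀ C ∈ φ, C.Nodup) :
    φ.encode.length ≤ 2 + φ.length * (2 * n + 1) := by
  have : ∀ l : List (List (Fin n × Bool)), (∀ C ∈ l, C.Nodup) →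
      (l.flatMap fun C => C.length :: C.map litCode).length ≤ l.length * (2 * n + 1) := by
    intro l hl
    induction l with
    | nil => simp
    | cons C l ih =>
      have h₁ := length_le (hl C (by simp))
      have h₂ := ih fun C hC => hl C (by simp [hC])
      simp only [List.flatMap_cons, List.length_append, List.length_cons, List.length_map] at h₂ ⊢
      rw [add_mul]
      omega
  have e : φ.encode = n :: φ.length :: φ.flatMap fun C => C.length :: C.map litCode := rfl
  have := this φ h
  rw [e]
  simp only [List.length_cons]
  omega

theorem le_of_mem_encode (h : ∀ C ∈ φ, C.Nodup) {x : ℕ} (hx : x ∈ φ.encode) :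
    x ≤ max φ.length (2 * n) := by
  simp only [encode, List.mem_cons, List.mem_flatMap, List.mem_map] at hx
  rcases hx with rfl | rfl | ⟨C, hC, rfl | ⟨l, -, rfl⟩⟩
  · omega
  · omega
  · have := length_le (h C hC)
    omega
  · have := l.1.2
    split_ifs <;> omega

theorem start_bounded (h : ∀ C ∈ φ, C.Nodup) {M : ℕ} (hM : 2 ≤ M) (hm : φ.length ≤ M)
    (hn : 2 * n ≤ M) : (start φ.encode).Bounded M where
  two_le := hM
  reg_le x := by simp [start]
  arr_le a i := by
    simp only [start]
    split_ifs
    · rw [List.getD_eq_getElem?_getD]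
      cases hi : φ.encode[i]? with
      | none => simp
      | some x =>
        have := le_of_mem_encode φ h (List.mem_of_getElem? hi)
        simp only [Option.getD_some]
        omega
    · omega

/-- The bound `6 * rounds φ` on memory covers the input, the vertex numbers and the edge count, as
each round adds at most six edges. Reading the formula costs only O(N^2 d) operations, so the main
loop dominates. -/
theorem build_run (h : ∀ C ∈ φ, C.Nodup) :
    ∃ (s : State) (t : ℕ) (E : List (Fin (order (numVec n) φ.dim) × Fin (order (numVec n) φ.dim))),
      Exec (seq setup buildLoop) (start φ.encode) s t ∧
      t ≤ buildTime * (rounds φ * (Nat.size (6 * rounds φ) + 1)) ∧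
      IsEdgeList E (finGraph φ.vec) ∧ E.length ≤ 6 * rounds φ ∧
      s.upper 32 = start (encodeGraph E) := by
  have hN := lt_numVec n
  have hd : φ.length + 4 = φ.dim := rfl
  have hN₄ : 4 ≤ numVec n := by simp only [numVec]; have := Nat.one_le_two_pow (n := blockSize n); omega
  have hD : φ.dim ≤ φ.dim ^ 5 := Nat.le_self_pow (by norm_num) _
  have hNN : numVec n ≤ numVec n * numVec n := Nat.le_mul_of_pos_left _ (by omega)
  have hI : numVec n * numVec n * φ.dim ^ 5 ≤ rounds φ := by
    rw [rounds, mul_assoc, mul_assoc, mul_assoc]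
    refine Nat.mul_le_mul_left _ (Nat.mul_le_mul_left _ ?_)
    calc φ.dim ^ 5 ≤ φ.dim ^ 5 * φ.dim ^ 5 := Nat.le_mul_of_pos_left _ (by omega)
      _ ≤ _ := Nat.le_mul_of_pos_left _ (by omega)
  have hI₁ : numVec n * numVec n * φ.dim ≤ rounds φ := (Nat.mul_le_mul_left _ hD).trans hI
  have hI₂ : numVec n * φ.dim ≤ rounds φ := (Nat.mul_le_mul_right _ hNN).trans hI₁
  have hI₃ : numVec n * numVec n * numVec n ≤ rounds φ :=
    Nat.le_mul_of_pos_right _ (Nat.mul_pos (by omega) (by omega))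
  have hI₄ : φ.dim ^ 5 ≤ rounds φ :=
    (Nat.le_mul_of_pos_left _ (Nat.mul_pos (by omega) (by omega))).trans hI
  have hNI : numVec n ≤ rounds φ := (Nat.le_mul_of_pos_right _ (by omega)).trans hI₂
  have hlen : φ.encode.length ≤ 6 * rounds φ := by
    refine (encode_length_le φ h).trans ?_
    have : φ.length * (2 * n + 1) ≤ φ.dim * (2 * numVec n) := Nat.mul_le_mul (by omega) (by omega)
    nlinarith
  have hs : (start φ.encode).Bounded (6 * rounds φ) :=
    start_bounded φ h (by omega) (by omega) (by omega)
  have hV : order (numVec n) φ.dim ≤ 6 * rounds φ := by rw [order]; omega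
  obtain ⟨s, t, hex, ht, -, hR⟩ := Run.seq ((setup_run hs hlen (by rw [← rounds]; omega) hV (by omega)
    (by omega) (L := 2 * n) fun C hC => length_le (h C hC)).mono le_rfl
    fun s _ hR hs => buildLoop_run hs (by rw [← rounds]) hV hR)
  obtain ⟨E, hE, hEl, hup⟩ := hR.isEdgeList
  refine ⟨s, t, E, hex, ht.trans ?_, hE, hEl, hup⟩
  rw [← mul_assoc buildTime]
  refine Nat.mul_le_mul_right _ ?_
  rw [← rounds, buildTime]
  -- `2 * n` bounds the length of a clause without repeated literals, and `n < numVec n` turns this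
  -- into a factor N.
  have h₁ : (numVec n + 1) * ((φ.length + 1) * (2 * n + 1)) ≤ 4 * rounds φ := by
    calc (numVec n + 1) * ((φ.length + 1) * (2 * n + 1))
        ≤ (2 * numVec n) * (φ.dim * (2 * numVec n)) :=
          Nat.mul_le_mul (by omega) (Nat.mul_le_mul (by omega) (by omega))
      _ = 4 * (numVec n * numVec n * φ.dim) := by ring
      _ ≤ _ := Nat.mul_le_mul_left _ hI₁
  have h₂ := Nat.mul_le_mul_left setupTime h₁
  have h₃ : 1 ≤ rounds φ := by omega
  generalize (sub (reg 5) (reg 6)).charge + 1 + round.charge = u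
  generalize (sub (reg 5) (reg 6)).charge + 1 = v
  have h₄ : v ≤ v * rounds φ := Nat.le_mul_of_pos_right _ (by omega)
  linarith

theorem connected_vec : (graph φ.vec).Connected := by
  have : Nonempty (Fin (numVec n)) := ⟨⟨0, numVec_pos n⟩⟩
  have : Nonempty (Fin φ.dim) := ⟨⟨0, dim_pos φ⟩⟩
  exact connected φ.exists_vec_triple

/-- The approximation algorithm is promised an edge. At least four coordinates exist, so two
different tuples on one pair give one. -/
theorem one_le_length {E : List (Fin (order (numVec n) φ.dim) × Fin (order (numVec n) φ.dim))}
    (hE : IsEdgeList E (finGraph φ.vec)) : 1 ≤ E.length := by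
  let o : Fin (numVec n) := ⟨0, numVec_pos n⟩
  let x : Fin 5 → Fin φ.dim := fun _ => ⟨0, dim_pos φ⟩
  let y : Fin 5 → Fin φ.dim := fun _ => ⟨1, by simp [dim]⟩
  have hadj : (finGraph φ.vec).Adj (code (.outer o o x)) (code (.outer o o y)) := by
    rw [finGraph, SimpleGraph.comap_adj, Equiv.symm_apply_apply, Equiv.symm_apply_apply]
    refine ⟨fun h => ?_, .inl (.shiftOuter o o x y)⟩
    injection h with _ _ h
    simpa [x, y] using congrArg Fin.val (congrFun h 0)
  have := (hE.2 _ _).1 hadj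
  by_contra hlt
  have hnil : E = [] := List.eq_nil_of_length_eq_zero (by omega)
  simp [hnil] at this

theorem diam_le (h : ¬ φ.Satisfiable) : (finGraph φ.vec).diam ≤ 4 := by
  have := ediam_le_of_allMeet (φ.allMeet_vec h)
  rw [← ediam_finGraph] at this
  exact ENat.toNat_le_of_le_natCast this

theorem le_diam (h : φ.Satisfiable) : 7 ≤ (finGraph φ.vec).diam := by
  obtain ⟨a, b, c, d, horth⟩ := φ.exists_orthogonal h
  have h₇ := seven_le_ediam φ.exists_vec_triple horth
  rw [← ediam_finGraph] at h₇
  have hc := connected_finGraph _ (connected_vec φ)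
  have := hc.nonempty
  -- Finiteness is essential: an infinite diameter would be read as `0` in the natural numbers.
  have hne := SimpleGraph.connected_iff_ediam_ne_top.1 hc
  have := ENat.toNat_le_toNat h₇ hne
  simpa [SimpleGraph.diam] using this

/-- An estimate of quality below `7 / 4` tells diameter `4` from diameter `7`. -/
theorem estimate_iff {D p q : ℕ} {ε : ℝ} (hε : 0 < ε) (hq : q ≠ 0)
    (h₁ : (D : ℝ) ≤ (7 / 4 - ε) * ((p : ℝ) / q)) (h₂ : (p : ℝ) / q ≤ D) :
    (D ≤ 4 → p - 4 * q = 0) ∧ (7 ≤ D → p - 4 * q ≠ 0) := by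
  have hq' : (0 : ℝ) < q := by positivity
  constructor
  · intro h
    have h₃ : (p : ℝ) / q ≤ 4 := h₂.trans (by exact_mod_cast h)
    rw [div_le_iff₀ hq'] at h₃
    have : p ≤ 4 * q := by exact_mod_cast h₃
    omega
  · intro h hp
    have h₃ : (p : ℝ) ≤ 4 * q := by exact_mod_cast (by omega : p ≤ 4 * q)
    have h₄ : (p : ℝ) / q ≤ 4 := by rwa [div_le_iff₀ hq']
    have h₅ : (0 : ℝ) ≤ (p : ℝ) / q := by positivity
    have h₆ : (7 : ℝ) ≤ D := by exact_mod_cast h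
    generalize (p : ℝ) / q = r at *
    rcases h₅.eq_or_lt with h₇ | h₇
    · rw [← h₇] at h₁
      linarith
    · nlinarith [mul_pos hε h₇]

/-- The final comparison handles the output of `P`, whose bit length is at most the running time of
`P`; together with that running time this gives the factor 5. -/
theorem reduction_run {P : Program} {ε : ℝ} {T : ℕ → ℝ} (hε : 0 < ε)
    (hP : ApproximatesDiameter P (7 / 4 - ε) T) (h : ∀ C ∈ φ, C.Nodup) :
    ∃ (s : State) (t m : ℕ), Exec (reduction P) (start φ.encode) s t ∧
      1 ≤ m ∧ m ≤ 6 * rounds φ ∧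
      (t : ℝ) ≤ buildTime * (rounds φ * (Nat.size (6 * rounds φ) + 1)) + 5 * T m + 20 ∧
      (s.reg 0 ≠ 0 ↔ φ.Satisfiable) := by
  obtain ⟨s₁, t₁, E, hex₁, ht₁, hE, hEl, hup⟩ := build_run φ h
  have hlen := one_le_length φ hE
  obtain ⟨s₂, t₂, hex₂, ht₂, hq, h₁, h₂⟩ :=
    hP _ (finGraph φ.vec) E (connected_finGraph _ (connected_vec φ)) hE hlen
  obtain ⟨S, rfl, hex₃⟩ := hex₂.shift s₁ hup
  refine ⟨_, _, E.length, .seq hex₁ (.seq hex₃ (.set 0 _ S)), hlen, hEl, ?_, ?_⟩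
  · have hz : ∀ x, (start (encodeGraph E)).reg x = 0 := fun _ => rfl
    have k₀ : Nat.size (S.reg 32) ≤ t₂ := by
      simpa [hz, State.upper] using hex₂.size_reg_le 0
    have k₁ : Nat.size (S.reg 33) ≤ t₂ := by
      simpa [hz, State.upper] using hex₂.size_reg_le 1
    have k₂ : Nat.size (4 * S.reg 33) ≤ t₂ + 2 := by
      rw [Nat.size_le] at k₁ ⊢
      rw [pow_add]
      omega
    have k₃ : Nat.size (S.reg 32 - 4 * S.reg 33) ≤ t₂ :=
      (Nat.size_le_size (Nat.sub_le _ _)).trans k₀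
    have k₄ : Nat.size 4 ≤ 3 := by rw [Nat.size_le]; norm_num
    have hcost : (sub (reg 32) (mul (const 4) (reg 33))).cost S ≤ 4 * t₂ + 15 := by
      simp only [Expr.cost, Expr.eval]
      omega
    have e₁ : (((t₁ + (t₂ + ((sub (reg 32) (mul (const 4) (reg 33))).cost S + 1)) : ℕ)) : ℝ) ≤
        t₁ + 5 * t₂ + 20 := by
      exact_mod_cast (by omega : _ ≤ t₁ + 5 * t₂ + 20)
    have e₂ : (t₁ : ℝ) ≤ buildTime * (rounds φ * (Nat.size (6 * rounds φ) + 1)) := by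
      exact_mod_cast ht₁
    linarith
  · obtain ⟨k₄, k₇⟩ := estimate_iff hε hq h₁ h₂
    have e : (sub (reg 32) (mul (const 4) (reg 33))).eval S =
        (S.upper 32).reg 0 - 4 * (S.upper 32).reg 1 := rfl
    simp only [Function.update_self, e]
    constructor
    · intro hne
      by_contra hsat
      exact hne (k₄ (diam_le φ hsat))
    · exact fun hsat => k₇ (le_diam φ hsat)

end QuadGraph

/-! ## Running times -/

namespace QuadGraph

open CNFFormula

theorem exists_pow_le (k : ℕ) {ζ : ℝ} (hζ : 0 < ζ) :
    ∃ C : ℝ, 0 ≤ C ∧ ∀ n : ℕ, ((n : ℝ) + 1) ^ k ≤ C * (2 : ℝ) ^ (ζ * n) := by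
  have hr : |(2 : ℝ) ^ (-ζ)| < 1 := by
    rw [abs_of_pos (by positivity)]
    exact Real.rpow_lt_one_of_one_lt_of_neg (by norm_num) (by linarith)
  obtain ⟨C, hC⟩ := (tendsto_pow_const_mul_const_pow_of_abs_lt_one k hr).bddAbove_range
  have hC' : ∀ n : ℕ, (n : ℝ) ^ k * ((2 : ℝ) ^ (-ζ)) ^ n ≤ C := fun n => hC ⟨n, rfl⟩
  have hC₀ : 0 ≤ C := le_trans (by positivity) (hC' 1)
  refine ⟨C * (2 : ℝ) ^ ζ, by positivity, fun n => ?_⟩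
  -- The sequence is used at `n + 1`, at the price of a constant factor 2^ζ.
  have h := hC' (n + 1)
  rw [← Real.rpow_natCast ((2 : ℝ) ^ (-ζ)), ← Real.rpow_mul (by norm_num)] at h
  calc ((n : ℝ) + 1) ^ k
      = ((n + 1 : ℕ) : ℝ) ^ k * (2 : ℝ) ^ (-ζ * (n + 1 : ℕ)) * (2 : ℝ) ^ (ζ * (n + 1 : ℕ)) := by
        rw [mul_assoc, ← Real.rpow_add (by norm_num)]
        push_cast
        ring_nf
        simp
    _ ≤ C * (2 : ℝ) ^ (ζ * (n + 1 : ℕ)) := by gcongr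
    _ = C * (2 : ℝ) ^ ζ * (2 : ℝ) ^ (ζ * n) := by
        rw [mul_assoc, ← Real.rpow_add (by norm_num)]
        push_cast
        ring_nf

theorem exists_size_le {θ : ℝ} (hθ : 0 < θ) :
    ∃ C : ℝ, 0 ≤ C ∧ ∀ x : ℕ, 1 ≤ x → (Nat.size x : ℝ) + 1 ≤ C * (x : ℝ) ^ θ := by
  obtain ⟨C, hC, h⟩ := exists_pow_le 1 hθ
  refine ⟨2 * C, by positivity, fun x hx => ?_⟩
  obtain ⟨y, hy⟩ : ∃ y, Nat.size x = y + 1 :=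
    ⟨Nat.size x - 1, by have := Nat.size_pos.2 hx; omega⟩
  have hyx : 2 ^ y ≤ x := Nat.lt_size.1 (by omega)
  have h₁ := h y
  have h₂ : (2 : ℝ) ^ (θ * y) ≤ (x : ℝ) ^ θ := by
    rw [mul_comm, Real.rpow_mul (by norm_num), Real.rpow_natCast]
    exact Real.rpow_le_rpow (by positivity) (by exact_mod_cast hyx) hθ.le
  rw [hy]
  push_cast
  have : (0 : ℝ) ≤ y := by positivity
  nlinarith [mul_le_mul_of_nonneg_left h₂ hC]

theorem numVec_le (n : ℕ) : (numVec n : ℝ) ≤ 8 * (2 : ℝ) ^ ((n : ℝ) / 4) := by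
  have h : (blockSize n : ℝ) ≤ (n : ℝ) / 4 + 1 := by
    have : 4 * blockSize n ≤ n + 4 := by simp only [blockSize]; omega
    have : (4 : ℝ) * blockSize n ≤ n + 4 := by exact_mod_cast this
    linarith
  calc (numVec n : ℝ) = 4 * (2 : ℝ) ^ (blockSize n : ℝ) := by simp [numVec]
    _ ≤ 4 * (2 : ℝ) ^ ((n : ℝ) / 4 + 1) := by gcongr; norm_num
    _ = 8 * (2 : ℝ) ^ ((n : ℝ) / 4) := by
        rw [Real.rpow_add (by norm_num), Real.rpow_one]; ring

/-- N^3 contributes 512 · 2^(3n/4), and d^10 is polynomial in `n` because the number of clauses is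
linear; 2^(ζn) absorbs it. -/
theorem exists_rounds_le (c : ℕ) {ζ : ℝ} (hζ : 0 < ζ) :
    ∃ C : ℝ, 0 ≤ C ∧ ∀ (n : ℕ) (φ : CNFFormula n), φ.length ≤ c * n →
      ((6 * rounds φ : ℕ) : ℝ) ≤ C * (2 : ℝ) ^ ((3 / 4 + ζ) * n) := by
  obtain ⟨C, hC, h⟩ := exists_pow_le 10 hζ
  refine ⟨6 * 512 * (c + 4) ^ 10 * C, by positivity, fun n φ hφ => ?_⟩
  have h₁ : (φ.dim : ℝ) ≤ (c + 4) * (n + 1) := by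
    have : φ.dim ≤ (c + 4) * (n + 1) := by simp only [dim]; nlinarith
    exact_mod_cast this
  have h₂ := numVec_le n
  calc ((6 * rounds φ : ℕ) : ℝ) = 6 * ((numVec n : ℝ) ^ 3 * (φ.dim : ℝ) ^ 10) := by
        simp only [rounds]; push_cast; ring
    _ ≤ 6 * ((8 * (2 : ℝ) ^ ((n : ℝ) / 4)) ^ 3 * ((c + 4) * (n + 1)) ^ 10) := by gcongr
    _ = 6 * 512 * (c + 4) ^ 10 * (2 : ℝ) ^ ((3 / 4 : ℝ) * n) * ((n : ℝ) + 1) ^ 10 := by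
        rw [mul_pow, ← Real.rpow_natCast ((2 : ℝ) ^ ((n : ℝ) / 4)), ← Real.rpow_mul (by norm_num)]
        push_cast
        ring_nf
    _ ≤ 6 * 512 * (c + 4) ^ 10 * (2 : ℝ) ^ ((3 / 4 : ℝ) * n) * (C * (2 : ℝ) ^ (ζ * n)) := by
        gcongr; exact h n
    _ = 6 * 512 * (c + 4) ^ 10 * C * (2 : ℝ) ^ ((3 / 4 + ζ) * n) := by
        rw [add_mul, Real.rpow_add (by norm_num)]; ring

/-- Writing the graph takes time linear up to a logarithm, so an exponent above 1 absorbs it along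
with the time of the approximation. Nothing is assumed about the sign of `K`, hence the absolute
value. -/
theorem exists_total_le {β γ : ℝ} (hβ : β ≤ γ) (hγ : 1 < γ) (A K : ℝ) (hA : 0 ≤ A) :
    ∃ C : ℝ, 0 ≤ C ∧ ∀ R m : ℕ, 1 ≤ m → m ≤ 6 * R →
      A * (R * (Nat.size (6 * R) + 1)) + 5 * (K * (m : ℝ) ^ β) + 20 ≤
        C * ((6 * R : ℕ) : ℝ) ^ γ := by
  obtain ⟨B, hB, h⟩ := exists_size_le (sub_pos.2 hγ)
  refine ⟨A * B + 5 * |K| + 20, by positivity, fun R m hm hmR => ?_⟩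
  have hX : (1 : ℝ) ≤ ((6 * R : ℕ) : ℝ) := by exact_mod_cast hm.trans hmR
  have hR : (R : ℝ) ≤ ((6 * R : ℕ) : ℝ) := by exact_mod_cast (by omega : R ≤ 6 * R)
  have hmX : (m : ℝ) ≤ ((6 * R : ℕ) : ℝ) := by exact_mod_cast hmR
  have hsize := h (6 * R) (hm.trans hmR)
  generalize ((6 * R : ℕ) : ℝ) = X at *
  have hm₁ : (1 : ℝ) ≤ m := by exact_mod_cast hm
  have h₁ : (m : ℝ) ^ β ≤ X ^ γ :=
    (Real.rpow_le_rpow_of_exponent_le hm₁ hβ).trans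
      (Real.rpow_le_rpow (by positivity) hmX (by linarith))
  have h₂ : K * (m : ℝ) ^ β ≤ |K| * X ^ γ :=
    mul_le_mul (le_abs_self K) h₁ (by positivity) (abs_nonneg K)
  have h₃ : (R : ℝ) * (Nat.size (6 * R) + 1) ≤ B * X ^ γ := by
    calc (R : ℝ) * (Nat.size (6 * R) + 1) ≤ X * (B * X ^ (γ - 1)) := by gcongr
      _ = B * X ^ γ := by
          rw [Real.rpow_sub (by linarith), Real.rpow_one]
          field_simp
  have h₄ : 1 ≤ X ^ γ := Real.one_le_rpow hX (by linarith)
  nlinarith [mul_le_mul_of_nonneg_left h₃ hA]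

end QuadGraph

/-- Assuming SETH, for every `ε > 0`, a `(7/4 - ε)`-approximation of the diameter of undirected
unweighted graphs with `m` edges needs time `m ^ (4/3 - o(1))`: for no `δ > 0` is there such an
algorithm of running time `O(m ^ (4/3 - δ))`. -/
theorem theorem2 (hSETH : SETH) (ε : ℝ) (hε : 0 < ε) (δ : ℝ) (hδ : 0 < δ) :
    ¬ ∃ (P : RAM.Program) (K : ℝ),
      ApproximatesDiameter P (7 / 4 - ε) fun m => K * (m : ℝ) ^ ((4 / 3 : ℝ) - δ) := by
  rintro ⟨P, K, hP⟩
  -- The cap 1/3 keeps the exponent 4/3 - η/2 above 1, as the time for writing the graph requires.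
  obtain ⟨η, hη, hη₁, hηδ⟩ : ∃ η : ℝ, 0 < η ∧ η ≤ 1 / 3 ∧ η ≤ δ :=
    ⟨min (1 / 3) δ, lt_min (by norm_num) hδ, min_le_left _ _, min_le_right _ _⟩
  obtain ⟨c, hc⟩ := hSETH (η / 4) (by linarith)
  obtain ⟨C₁, hC₁, h₁⟩ := QuadGraph.exists_total_le (β := 4 / 3 - δ) (γ := 4 / 3 - η / 2)
    (by linarith) (by linarith) QuadGraph.buildTime K (by positivity)
  obtain ⟨C₂, hC₂, h₂⟩ := QuadGraph.exists_rounds_le c (ζ := 3 * η / 32) (by linarith)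
  refine hc ⟨QuadGraph.reduction P, C₁ * C₂ ^ (4 / 3 - η / 2 : ℝ), fun n φ hφ hlen => ?_⟩
  obtain ⟨s, t, m, hex, hm, hmR, ht, hs⟩ := QuadGraph.reduction_run φ hε hP hφ
  refine ⟨s, t, hex, ht.trans ((h₁ _ m hm hmR).trans ?_), hs⟩
  calc C₁ * ((6 * QuadGraph.rounds φ : ℕ) : ℝ) ^ (4 / 3 - η / 2 : ℝ)
      ≤ C₁ * (C₂ * (2 : ℝ) ^ ((3 / 4 + 3 * η / 32) * n)) ^ (4 / 3 - η / 2 : ℝ) := by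
        gcongr
        · linarith
        · exact h₂ n φ hlen
    _ = C₁ * C₂ ^ (4 / 3 - η / 2 : ℝ) *
        (2 : ℝ) ^ ((3 / 4 + 3 * η / 32) * n * (4 / 3 - η / 2)) := by
        rw [Real.mul_rpow hC₂ (by positivity), ← Real.rpow_mul (by norm_num)]; ring
    _ ≤ C₁ * C₂ ^ (4 / 3 - η / 2 : ℝ) * (2 : ℝ) ^ ((1 - η / 4) * (n : ℝ)) := by
        refine mul_le_mul_of_nonneg_left
          (Real.rpow_le_rpow_of_exponent_le (by norm_num) ?_) (by positivity)
        have h₃ : (0 : ℝ) ≤ n := by positivity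
        -- The choice ζ = 3η/32 makes the product 1 - η/4 - 3η²/64: lowering the exponent saves
        -- 3η/8, of which ζ returns only η/8.
        have h₄ : (3 / 4 + 3 * η / 32) * (4 / 3 - η / 2) ≤ 1 - η / 4 := by nlinarith
        nlinarith
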